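/- Let $N\in\mathbb N$, $1<p<N$, $0\le\mu<\left(\frac{N-p}{p}\right)^p$ and $p^*=\frac{Np}{N-p}$. Let $0\le\gamma_1<\gamma_2$ be the two roots in $[0,\infty)$ of $$\gamma^{p-2}\left[(p-1)\gamma^2-(N-p)\gamma\right]+\mu=0 ,$$ where, for $1<p<2$, the first term is read as $0$ at $\gamma=0$. Let $\Omega\subset\mathbb R^N$ be a bounded domain (a bounded connected open set) containing the origin, and let $f\in L^{N/p}(\Omega)$ with $f\ge 0$ a.e. in $\Omega$. Let $\mathcal D^{1,p}(\Omega)$ be the space of all $v\in L^{p^*}(\Omega)$ that are weakly differentiable with $\nabla v\in L^p(\Omega)$. Let $u\in\mathcal D^{1,p}(\Omega)$ be nonnegative a.e. in $\Omega$ and a weak supersolution of $$-\Delta_p u-\frac{\mu}{|x|^p}|u|^{p-2}u=f|u|^{p-2}u\quad\text{in }\Omega,$$ that is, $$\int_\Omega\left(|\nabla u|^{p-2}\nabla u\cdot\nabla\varphi-\frac{\mu}{|x|^p}|u|^{p-2}u\,\varphi\right)dx\ \ge\ \int_\Omega f|u|^{p-2}u\,\varphi\,dx$$ for every nonnegative $\varphi\in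 C_0^\infty(\Omega)$ (smooth with compact support in $\Omega$). Then $$u(x)\ \ge\ C\,m\,|x|^{-\gamma_1}\qquad\text{for a.e. }x\in\Omega,$$ where $m=\operatorname{ess\,inf}_\Omega u$ and $C=\inf_{x\in\partial\Omega}|x|^{\gamma_1}$. -/

import Mathlib

open MeasureTheory Set
open scoped ContDiff

/-- Test functions `φ ∈ C₀^∞(Ω)`: smooth, with compact support contained in `Ω`. -/
def IsTestFunction {N : ℕ} (Ω : Set (EuclideanSpace ℝ (Fin N)))
    (φ : EuclideanSpace ℝ (Fin N) → ℝ) : Prop :=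
  ContDiff ℝ ∞ φ ∧ HasCompactSupport φ ∧ tsupport φ ⊆ Ω

/-- `G` is a weak gradient of `u` on the open set `Ω`: both are locally integrable on `Ω`, and
`∫_Ω u ∂ᵢφ = -∫_Ω Gᵢ φ` for every test function `φ` and every coordinate `i`. -/
def HasWeakGradient {N : ℕ} (Ω : Set (EuclideanSpace ℝ (Fin N)))
    (u : EuclideanSpace ℝ (Fin N) → ℝ)
    (G : EuclideanSpace ℝ (Fin N) → EuclideanSpace ℝ (Fin N)) : Prop :=
  LocallyIntegrableOn u Ω volume ∧ LocallyIntegrableOn G Ω volume ∧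
    ∀ φ : EuclideanSpace ℝ (Fin N) → ℝ, IsTestFunction Ω φ → ∀ i : Fin N,
      ∫ x in Ω, u x * gradient φ x i = - ∫ x in Ω, G x i * φ x

/-- `u ∈ 𝒟^{1,p}(Ω)`: `u ∈ L^{p*}(Ω)` with `p* = Np/(N-p)`, and `u` is weakly differentiable
with `∇u ∈ L^p(Ω)`. -/
def MemD1p {N : ℕ} (p : ℝ) (Ω : Set (EuclideanSpace ℝ (Fin N)))
    (u : EuclideanSpace ℝ (Fin N) → ℝ) : Prop :=
  MemLp u (ENNReal.ofReal (N * p / (N - p))) (volume.restrict Ω) ∧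
    ∃ G : EuclideanSpace ℝ (Fin N) → EuclideanSpace ℝ (Fin N),
      HasWeakGradient Ω u G ∧ MemLp G (ENNReal.ofReal p) (volume.restrict Ω)

/-- `u ∈ 𝒟^{1,p}(Ω)` is a weak subsolution in `Ω` of
`-Δ_p u - (μ/|x|^p) |u|^{p-2} u = f |u|^{p-2} u`.
The weak gradient `G` of `u` is unique up to null sets, and exists by `MemD1p`. -/
def IsWeakSubsolution {N : ℕ} (p μ : ℝ) (Ω : Set (EuclideanSpace ℝ (Fin N)))
    (f u : EuclideanSpace ℝ (Fin N) → ℝ) : Prop :=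
  MemD1p p Ω u ∧
    ∀ G : EuclideanSpace ℝ (Fin N) → EuclideanSpace ℝ (Fin N), HasWeakGradient Ω u G →
      ∀ φ : EuclideanSpace ℝ (Fin N) → ℝ, IsTestFunction Ω φ → (∀ x, 0 ≤ φ x) →
        ∫ x in Ω, (‖G x‖ ^ (p - 2) * inner ℝ (G x) (gradient φ x)
            - μ / ‖x‖ ^ p * |u x| ^ (p - 2) * u x * φ x)
          ≤ ∫ x in Ω, f x * |u x| ^ (p - 2) * u x * φ x

/-- `u` is a weak supersolution if `-u` is a weak subsolution. -/
def IsWeakSupersolution {N : ℕ} (p μ : ℝ) (Ω : Set (EuclideanSpace ℝ (Fin N)))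
    (f u : EuclideanSpace ℝ (Fin N) → ℝ) : Prop :=
  IsWeakSubsolution p μ Ω f (fun x => - u x)

/-- `0 ≤ γ₁ < γ₂` are the two roots in `[0, ∞)` of
`γ^{p-2} [(p-1) γ² - (N-p) γ] + μ = 0`.
For `1 < p < N` and `0 ≤ μ < ((N-p)/p)^p` there are exactly two such roots, since the left-hand
side is strictly decreasing and then strictly increasing in `γ`. -/
def AreCharacteristicRoots (N : ℕ) (p μ γ₁ γ₂ : ℝ) : Prop :=
  0 ≤ γ₁ ∧ γ₁ < γ₂ ∧
    γ₁ ^ (p - 2) * ((p - 1) * γ₁ ^ 2 - (N - p) * γ₁) + μ = 0 ∧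
    γ₂ ^ (p - 2) * ((p - 1) * γ₂ ^ 2 - (N - p) * γ₂) + μ = 0

/-! Since `f` and `u` are nonnegative, the term with `f` has a favourable sign and `u` satisfies
`-Δ_p u ≥ μ |x|^{-p} u^{p-1}` weakly. A power `w = |x|^{-b}` solves `-Δ_p w = κ(b) |x|^{-p} w^{p-1}`
away from the origin, with `κ = hardyCoeff N p` strictly increasing up to `(N-p)/p` and strictly
decreasing beyond. The smaller root `γ₁` of `κ = μ` lies on the increasing branch, so `κ(a) < μ` for
`0 < a < γ₁`.

This strict gap pays for a regularisation at the origin. `exists_barrier` flattens `m (R/|x|)^a`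
near `0` into a smooth bounded positive `V` with `-Δ_p V ≤ lam |x|^{-p} V^{p-1}` for some `lam < μ`.
A bound `k V ≤ u` then gives `-Δ_p u ≥ μ |x|^{-p} (k V)^{p-1}`, and comparison improves it to `k' V
≤ u` whenever `lam k'^{p-1} ≤ μ k^{p-1}` and `k' ≤ 1` (`barrier_step`). Boundedness of `V` and `u ≥
m > 0` provide a first `k > 0`. Each step gains the fixed factor `(μ/lam)^{1/(p-1)} > 1`, so `k = 1`
is reached after finitely many steps. The flattening region then shrinks to the origin, `a`
increases to `γ₁`, and `R` increases to the radius with `R^{γ₁} = C`, whose open ball lies in `Ω`.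

Comparison (`weak_comparison`) rests on strict monotonicity of the flux `|ξ|^{p-2} ξ`. The natural
test function, a positive part of `V - u`, is not smooth, so `u` is mollified and the positive part
is replaced by a smooth function. The passage to the limit uses `L^p` convergence of the mollified
gradient and an `L¹` Poincaré inequality. -/

open Filter Topology

/-! ### Monotonicity of the p-Laplacian flux -/

/-- The vector field `ξ ↦ |ξ|^{p-2} ξ` defining the `p`-Laplacian. -/
noncomputable def pFlux {N : ℕ} (p : ℝ) (ξ : EuclideanSpace ℝ (Fin N)) :
    EuclideanSpace ℝ (Fin N) := ‖ξ‖ ^ (p - 2) • ξ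

theorem norm_pFlux {N : ℕ} {p : ℝ} (hp : 1 < p) (ξ : EuclideanSpace ℝ (Fin N)) :
    ‖pFlux p ξ‖ = ‖ξ‖ ^ (p - 1) := by
  rw [pFlux, norm_smul, Real.norm_of_nonneg (by positivity)]
  rcases eq_or_ne ξ 0 with rfl | h
  · simp [Real.zero_rpow (by linarith : p - 1 ≠ 0)]
  · have h0 : 0 < ‖ξ‖ := norm_pos_iff.2 h
    rw [show p - 1 = (p - 2) + 1 by ring, Real.rpow_add h0, Real.rpow_one]

theorem pFlux_smul {N : ℕ} {p k : ℝ} (hp : 1 < p) (hk : 0 ≤ k) (ξ : EuclideanSpace ℝ (Fin N)) :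
    pFlux p (k • ξ) = k ^ (p - 1) • pFlux p ξ := by
  rcases eq_or_lt_of_le hk with rfl | h0
  · simp [pFlux, Real.zero_rpow (by linarith : p - 1 ≠ 0)]
  · rw [pFlux, pFlux, norm_smul, Real.norm_of_nonneg hk, Real.mul_rpow hk (norm_nonneg _),
      smul_smul, smul_smul, show p - 1 = (p - 2) + 1 by ring, Real.rpow_add h0, Real.rpow_one]
    ring_nf

theorem norm_rpow_sub_two_mul {p a : ℝ} (hp : 1 < p) (ha : 0 ≤ a) :
    a ^ (p - 2) * a = a ^ (p - 1) := by
  rcases eq_or_lt_of_le ha with rfl | h0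
  · simp [Real.zero_rpow (by linarith : p - 1 ≠ 0)]
  · rw [show p - 1 = (p - 2) + 1 by ring, Real.rpow_add h0, Real.rpow_one]

/-- After expansion the mixed term is `-(‖ξ‖^{p-2} + ‖η‖^{p-2}) ⟨ξ, η⟩`, and Cauchy–Schwarz replaces
`⟨ξ, η⟩` by `‖ξ‖ ‖η‖`. Vector monotonicity thus reduces to that of `t ↦ t^{p-1}`, for every `p > 1`
at once. -/
theorem inner_pFlux_sub_ge {N : ℕ} {p : ℝ} (hp : 1 < p) (ξ η : EuclideanSpace ℝ (Fin N)) :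
    (‖ξ‖ ^ (p - 1) - ‖η‖ ^ (p - 1)) * (‖ξ‖ - ‖η‖) ≤
      inner ℝ (pFlux p ξ - pFlux p η) (ξ - η) := by
  have h1 := real_inner_le_norm ξ η
  have e1 := norm_rpow_sub_two_mul hp (norm_nonneg ξ)
  have e2 := norm_rpow_sub_two_mul hp (norm_nonneg η)
  have s0 : 0 ≤ ‖ξ‖ ^ (p - 2) := by positivity
  have t0 : 0 ≤ ‖η‖ ^ (p - 2) := by positivity
  rw [← e1, ← e2]
  simp only [pFlux, inner_sub_left, inner_sub_right, real_inner_smul_left,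
    real_inner_self_eq_norm_sq]
  rw [real_inner_comm ξ η]
  nlinarith [mul_nonneg s0 (sub_nonneg.2 h1), mul_nonneg t0 (sub_nonneg.2 h1)]

theorem inner_pFlux_sub_nonneg {N : ℕ} {p : ℝ} (hp : 1 < p) (ξ η : EuclideanSpace ℝ (Fin N)) :
    0 ≤ inner ℝ (pFlux p ξ - pFlux p η) (ξ - η) := by
  refine le_trans ?_ (inner_pFlux_sub_ge hp ξ η)
  rcases le_total ‖ξ‖ ‖η‖ with h | h
  · have := Real.rpow_le_rpow (norm_nonneg _) h (by linarith : 0 ≤ p - 1)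
    nlinarith
  · have := Real.rpow_le_rpow (norm_nonneg _) h (by linarith : 0 ≤ p - 1)
    nlinarith

/-- The scalar bound forces equal norms. The flux difference is then a common positive factor times
`ξ - η`, unless both vectors vanish. -/
theorem eq_of_inner_pFlux_sub_le_zero {N : ℕ} {p : ℝ} (hp : 1 < p)
    {ξ η : EuclideanSpace ℝ (Fin N)} (h : inner ℝ (pFlux p ξ - pFlux p η) (ξ - η) ≤ 0) :
    ξ = η := by
  have h1 := (inner_pFlux_sub_ge hp ξ η).trans h
  have hn : ‖ξ‖ = ‖η‖ := by
    rcases lt_trichotomy ‖ξ‖ ‖η‖ with h' | h' | h'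
    · have := Real.rpow_lt_rpow (norm_nonneg _) h' (by linarith : 0 < p - 1)
      nlinarith
    · exact h'
    · have := Real.rpow_lt_rpow (norm_nonneg _) h' (by linarith : 0 < p - 1)
      nlinarith
  rcases eq_or_lt_of_le (norm_nonneg ξ) with h0 | h0
  · rw [norm_eq_zero.1 h0.symm, norm_eq_zero.1 (hn.symm.trans h0.symm)]
  · have hs : 0 < ‖ξ‖ ^ (p - 2) := by positivity
    rw [pFlux, pFlux, ← hn, ← smul_sub, real_inner_smul_left, real_inner_self_eq_norm_sq] at h
    have : ‖ξ - η‖ ^ 2 ≤ 0 := by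
      by_contra hc
      push Not at hc
      nlinarith [mul_pos hs hc]
    have h3 : ‖ξ - η‖ = 0 := by nlinarith [norm_nonneg (ξ - η)]
    exact sub_eq_zero.1 (norm_eq_zero.1 h3)

/-! ### Convergence of mollifications in L^p -/

section Mollification

variable {E F : Type*} [NormedAddCommGroup E] [NormedSpace ℝ E] [FiniteDimensional ℝ E]
  [MeasurableSpace E] [BorelSpace E] [NormedAddCommGroup F]

/-- This is continuity of the translation action on `L^p`, which holds for finite exponents. -/
theorem tendsto_eLpNorm_translate_sub (ν : Measure E) [ν.IsAddHaarMeasure] {p : ENNReal}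
    (hp : 1 ≤ p) (hp' : p ≠ ⊤) {g : E → F} (hg : MemLp g p ν) :
    Tendsto (fun t => eLpNorm (fun x => g (x - t) - g x) p ν) (𝓝 0) (𝓝 0) := by
  have : Fact (1 ≤ p) := ⟨hp⟩
  have : Fact (p ≠ ⊤) := ⟨hp'⟩
  have hc : Continuous fun t : E => (DomAddAct.mk (-t) +ᵥ hg.toLp g : Lp F p ν) := by
    have : Continuous fun t : E => (DomAddAct.mk (-t) : Eᵈᵃᵃ) :=
      DomAddAct.continuous_mk.comp continuous_neg
    exact this.vadd continuous_const
  have h0 := tendsto_iff_edist_tendsto_0.1 (hc.tendsto 0)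
  refine h0.congr fun t => ?_
  rw [DomAddAct.mk_vadd_toLp, DomAddAct.mk_vadd_toLp, Lp.edist_toLp_toLp]
  congr 1
  ext x
  simp [sub_eq_neg_add]

variable [NormedSpace ℝ F] [CompleteSpace F]

/-- The mollifier is a probability density, so this is Jensen's inequality, obtained by comparing
the `L¹` and `L^p` norms for the measure with that density. -/
theorem enorm_convolution_sub_rpow_le (ν : Measure E) [ν.IsAddHaarMeasure] {p : ℝ} (hp : 1 ≤ p)
    {g : E → F} (hg : LocallyIntegrable g ν) (φ : ContDiffBump (0 : E)) (x : E) :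
    ‖convolution (φ.normed ν) g (ContinuousLinearMap.lsmul ℝ ℝ) ν x - g x‖ₑ ^ p ≤
      ∫⁻ t, ENNReal.ofReal (φ.normed ν t) * ‖g (x - t) - g x‖ₑ ^ p ∂ν := by
  set w : E → ENNReal := fun t => ENNReal.ofReal (φ.normed ν t) with hw
  have hwc : Continuous (φ.normed ν) := φ.continuous_normed
  have hwm : Measurable w := hwc.measurable.ennreal_ofReal
  have hgx : AEStronglyMeasurable (fun t => g (x - t) - g x) ν :=
    (hg.aestronglyMeasurable.comp_quasiMeasurePreserving
      (quasiMeasurePreserving_sub_left ν x)).sub aestronglyMeasurable_const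
  have hprob : IsProbabilityMeasure (ν.withDensity w) := by
    refine ⟨?_⟩
    rw [withDensity_apply _ MeasurableSet.univ, Measure.restrict_univ,
      ← ofReal_integral_eq_lintegral_ofReal φ.integrable_normed
        (Eventually.of_forall φ.nonneg_normed), φ.integral_normed, ENNReal.ofReal_one]
  have hJ := eLpNorm'_le_eLpNorm'_of_exponent_le (f := fun t => g (x - t) - g x) one_pos hp
    (ν.withDensity w) (hgx.mono_ac (withDensity_absolutelyContinuous _ _))
  have e1 : ∀ q : ℝ, 0 ≤ q → ∫⁻ t, ‖g (x - t) - g x‖ₑ ^ q ∂(ν.withDensity w) =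
      ∫⁻ t, w t * ‖g (x - t) - g x‖ₑ ^ q ∂ν := fun q hq => by
    rw [lintegral_withDensity_eq_lintegral_mul₀ hwm.aemeasurable (hgx.enorm.pow_const q)]
    rfl
  simp only [eLpNorm', e1 p (by linarith)] at hJ
  have e2 := e1 1 zero_le_one
  rw [e2] at hJ
  simp only [ENNReal.rpow_one, one_div, inv_one] at hJ
  have hI : convolution (φ.normed ν) g (ContinuousLinearMap.lsmul ℝ ℝ) ν x - g x =
      ∫ t, φ.normed ν t • (g (x - t) - g x) ∂ν := by
    have i1 : Integrable (fun t => φ.normed ν t • g (x - t)) ν :=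
      (φ.hasCompactSupport_normed.convolutionExists_left (ContinuousLinearMap.lsmul ℝ ℝ)
        hwc hg x)
    have i2 : Integrable (fun t => φ.normed ν t • g x) ν := φ.integrable_normed.smul_const _
    simp only [smul_sub]
    rw [integral_sub i1 i2, integral_smul_const, φ.integral_normed, one_smul]
    rfl
  rw [hI]
  have h3 : ‖∫ t, φ.normed ν t • (g (x - t) - g x) ∂ν‖ₑ ≤
      ∫⁻ t, w t * ‖g (x - t) - g x‖ₑ ∂ν := by
    refine (enorm_integral_le_lintegral_enorm _).trans (le_of_eq ?_)
    congr 1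
    ext t
    rw [enorm_smul, Real.enorm_of_nonneg (φ.nonneg_normed t)]
  calc _ ≤ (∫⁻ t, w t * ‖g (x - t) - g x‖ₑ ∂ν) ^ p := by gcongr
    _ ≤ ((∫⁻ t, w t * ‖g (x - t) - g x‖ₑ ^ p ∂ν) ^ p⁻¹) ^ p := by gcongr
    _ = _ := by rw [← ENNReal.rpow_mul, inv_mul_cancel₀ (by linarith), ENNReal.rpow_one]

theorem tendsto_eLpNorm_convolution_sub (ν : Measure E) [ν.IsAddHaarMeasure] {p : ℝ} (hp : 1 ≤ p)
    {g : E → F} (hg : MemLp g (ENNReal.ofReal p) ν) {ι : Type*} {l : Filter ι}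
    {φ : ι → ContDiffBump (0 : E)} (hφ : Tendsto (fun i => (φ i).rOut) l (𝓝 0)) :
    Tendsto (fun i => eLpNorm (fun x => convolution ((φ i).normed ν) g
      (ContinuousLinearMap.lsmul ℝ ℝ) ν x - g x) (ENNReal.ofReal p) ν) l (𝓝 0) := by
  have hp1 : 1 ≤ ENNReal.ofReal p := by simpa using ENNReal.ofReal_le_ofReal hp
  have hp0 : 0 < p := by linarith
  have hgl : LocallyIntegrable g ν := hg.locallyIntegrable hp1
  have hT := tendsto_eLpNorm_translate_sub ν hp1 ENNReal.ofReal_ne_top hg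
  rw [ENNReal.tendsto_nhds_zero] at hT ⊢
  intro ε hε
  obtain ⟨δ, hδ, hball⟩ := Metric.eventually_nhds_iff_ball.1 (hT ε hε)
  filter_upwards [hφ.eventually (gt_mem_nhds hδ)] with i hi
  have key : ∀ f : E → F, eLpNorm f (ENNReal.ofReal p) ν =
      (∫⁻ x, ‖f x‖ₑ ^ p ∂ν) ^ (1 / p) := fun f => by
    rw [eLpNorm_eq_lintegral_rpow_enorm_toReal (by simpa using hp0) ENNReal.ofReal_ne_top,
      ENNReal.toReal_ofReal hp0.le]
  rw [key, one_div, ENNReal.rpow_inv_le_iff hp0]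
  have hmeas : AEMeasurable (Function.uncurry fun x t =>
      ENNReal.ofReal ((φ i).normed ν t) * ‖g (x - t) - g x‖ₑ ^ p) (ν.prod ν) := by
    have m1 : AEMeasurable (fun z : E × E => ENNReal.ofReal ((φ i).normed ν z.2)) (ν.prod ν) :=
      ((φ i).continuous_normed.measurable.comp measurable_snd).ennreal_ofReal.aemeasurable
    have m2 : AEStronglyMeasurable (fun z : E × E => g (z.1 - z.2)) (ν.prod ν) :=
      hg.1.comp_quasiMeasurePreserving (quasiMeasurePreserving_sub ν ν)
    have m3 : AEStronglyMeasurable (fun z : E × E => g z.1) (ν.prod ν) :=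
      hg.1.comp_fst
    exact m1.mul ((m2.sub m3).enorm.pow_const p)
  -- By Tonelli, the error is at most an average of translation errors over shifts in the support of
  -- the mollifier, each below `ε ^ p` once that support lies in the ball of radius `δ`.
  calc ∫⁻ x, ‖convolution ((φ i).normed ν) g (ContinuousLinearMap.lsmul ℝ ℝ) ν x - g x‖ₑ ^ p ∂ν
      ≤ ∫⁻ x, ∫⁻ t, ENNReal.ofReal ((φ i).normed ν t) * ‖g (x - t) - g x‖ₑ ^ p ∂ν ∂ν :=
        lintegral_mono fun x => enorm_convolution_sub_rpow_le ν hp hgl (φ i) x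
    _ = ∫⁻ t, ∫⁻ x, ENNReal.ofReal ((φ i).normed ν t) * ‖g (x - t) - g x‖ₑ ^ p ∂ν ∂ν :=
        lintegral_lintegral_swap hmeas
    _ ≤ ∫⁻ t, ENNReal.ofReal ((φ i).normed ν t) * ε ^ p ∂ν := by
        refine lintegral_mono fun t => ?_
        rw [lintegral_const_mul' _ _ ENNReal.ofReal_ne_top]
        by_cases ht : t ∈ Metric.ball (0 : E) δ
        · have := hball t ht
          rw [key, one_div, ENNReal.rpow_inv_le_iff hp0] at this
          gcongr
        · have : (φ i).normed ν t = 0 := by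
            have hs := (φ i).support_normed_eq (μ := ν)
            by_contra hne
            have : t ∈ Function.support ((φ i).normed ν) := hne
            rw [hs] at this
            exact ht (Metric.ball_subset_ball hi.le this)
          simp [this]
    _ = ε ^ p := by
        rw [lintegral_mul_const _ (φ i).continuous_normed.measurable.ennreal_ofReal,
          ← ofReal_integral_eq_lintegral_ofReal (φ i).integrable_normed
            (Eventually.of_forall (φ i).nonneg_normed), (φ i).integral_normed,
          ENNReal.ofReal_one, one_mul]

end Mollification

/-! ### A smooth substitute for the positive part -/

section Primitive

/-- The primitive of `Real.smoothTransition` vanishing at `0`: a smooth approximation of the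
positive part. -/
noncomputable def smoothPos (t : ℝ) : ℝ := ∫ s in (0 : ℝ)..t, Real.smoothTransition s

theorem hasDerivAt_smoothPos (t : ℝ) : HasDerivAt smoothPos (Real.smoothTransition t) t :=
  intervalIntegral.integral_hasDerivAt_right (Real.smoothTransition.continuous.intervalIntegrable _ _)
    (Real.smoothTransition.continuous.stronglyMeasurableAtFilter _ _)
    Real.smoothTransition.continuousAt

theorem contDiff_smoothPos : ContDiff ℝ ∞ smoothPos := by
  rw [contDiff_infty_iff_deriv]
  refine ⟨fun t => (hasDerivAt_smoothPos t).differentiableAt, ?_⟩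
  rw [show deriv smoothPos = Real.smoothTransition from
    funext fun t => (hasDerivAt_smoothPos t).deriv]
  exact Real.smoothTransition.contDiff

theorem monotone_smoothPos : Monotone smoothPos :=
  monotone_of_hasDerivAt_nonneg hasDerivAt_smoothPos fun t => Real.smoothTransition.nonneg t

theorem smoothPos_of_nonpos {t : ℝ} (ht : t ≤ 0) : smoothPos t = 0 := by
  rw [smoothPos, intervalIntegral.integral_symm, intervalIntegral.integral_of_le ht,
    setIntegral_eq_zero_of_forall_eq_zero, neg_zero]
  exact fun s hs => Real.smoothTransition.zero_of_nonpos hs.2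

theorem smoothPos_nonneg (t : ℝ) : 0 ≤ smoothPos t := by
  rcases le_total t 0 with h | h
  · exact (smoothPos_of_nonpos h).ge
  · exact (smoothPos_of_nonpos le_rfl).ge.trans (monotone_smoothPos h)

theorem smoothPos_pos {t : ℝ} (ht : 0 < t) : 0 < smoothPos t := by
  refine intervalIntegral.intervalIntegral_pos_of_pos_on
    (Real.smoothTransition.continuous.intervalIntegrable _ _) (fun s hs => ?_) ht
  exact Real.smoothTransition.pos_of_pos hs.1

end Primitive

/-! ### Hölder pairing with a sequence tending to zero in L^p -/

theorem tendsto_integral_norm_mul_norm {α F F' ι : Type*} [MeasurableSpace α] {ν : Measure α}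
    [NormedAddCommGroup F] [NormedAddCommGroup F'] {p q : ℝ} (hpq : p.HolderConjugate q)
    {W : α → F} (hW : MemLp W (ENNReal.ofReal q) ν) {l : Filter ι} {h : ι → α → F'}
    (hh : ∀ i, MemLp (h i) (ENNReal.ofReal p) ν)
    (hlim : Tendsto (fun i => eLpNorm (h i) (ENNReal.ofReal p) ν) l (𝓝 0)) :
    Tendsto (fun i => ∫ x, ‖W x‖ * ‖h i x‖ ∂ν) l (𝓝 0) := by
  have h1 : ∀ i, ∫ x, ‖W x‖ * ‖h i x‖ ∂ν ≤ (∫ x, ‖W x‖ ^ q ∂ν) ^ (1 / q) *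
      (eLpNorm (h i) (ENNReal.ofReal p) ν).toReal := fun i => by
    have := integral_mul_norm_le_Lp_mul_Lq (f := fun x => ‖W x‖) (g := fun x => ‖h i x‖)
      hpq.symm hW.norm (hh i).norm
    simp only [norm_norm] at this
    refine this.trans (le_of_eq ?_)
    have hp0 := hpq.pos
    rw [(hh i).eLpNorm_eq_integral_rpow_norm (by simpa using hp0) ENNReal.ofReal_ne_top,
      ENNReal.toReal_ofReal (by positivity), ENNReal.toReal_ofReal hp0.le, one_div, one_div]
  have h2 : Tendsto (fun i => (∫ x, ‖W x‖ ^ q ∂ν) ^ (1 / q) *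
      (eLpNorm (h i) (ENNReal.ofReal p) ν).toReal) l (𝓝 0) := by
    have := ((ENNReal.tendsto_toReal ENNReal.zero_ne_top).comp hlim).const_mul
      ((∫ x, ‖W x‖ ^ q ∂ν) ^ (1 / q))
    simpa using this
  exact squeeze_zero (fun i => integral_nonneg fun x => by positivity) h1 h2

/-! ### Gradients, weak gradients and a Poincaré inequality -/

section Gradient

variable {N : ℕ}

theorem gradient_apply_eq_fderiv (φ : EuclideanSpace ℝ (Fin N) → ℝ)
    (x : EuclideanSpace ℝ (Fin N)) (i : Fin N) :
    gradient φ x i = fderiv ℝ φ x (EuclideanSpace.single i 1) := by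
  have h : inner ℝ (gradient φ x) (EuclideanSpace.single i (1 : ℝ)) =
      fderiv ℝ φ x (EuclideanSpace.single i 1) := by
    rw [gradient, InnerProductSpace.toDual_symm_apply]
  rw [← h, EuclideanSpace.inner_single_right]
  simp

theorem ContDiff.continuous_gradient {φ : EuclideanSpace ℝ (Fin N) → ℝ} (hφ : ContDiff ℝ 1 φ) :
    Continuous (gradient φ) :=
  (InnerProductSpace.toDual ℝ (EuclideanSpace ℝ (Fin N))).symm.continuous.comp
    (hφ.continuous_fderiv one_ne_zero)

theorem gradient_eq_zero_of_notMem_tsupport {φ : EuclideanSpace ℝ (Fin N) → ℝ}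
    {x : EuclideanSpace ℝ (Fin N)} (hx : x ∉ tsupport φ) : gradient φ x = 0 := by
  rw [gradient, fderiv_of_notMem_tsupport (𝕜 := ℝ) hx, map_zero]

/-- Mollification commutes with weak differentiation away from the boundary. -/
theorem gradient_convolution_eq {Ω : Set (EuclideanSpace ℝ (Fin N))} (hΩ : MeasurableSet Ω)
    {u ũ : EuclideanSpace ℝ (Fin N) → ℝ}
    {G : EuclideanSpace ℝ (Fin N) → EuclideanSpace ℝ (Fin N)} (hG : HasWeakGradient Ω u G)
    (hGi : IntegrableOn G Ω) (hũ : LocallyIntegrable ũ volume) (hũu : ∀ x ∈ Ω, ũ x = u x)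
    (η : ContDiffBump (0 : EuclideanSpace ℝ (Fin N))) (x : EuclideanSpace ℝ (Fin N))
    (hx : Metric.closedBall x η.rOut ⊆ Ω) :
    gradient (convolution (η.normed volume) ũ (ContinuousLinearMap.lsmul ℝ ℝ) volume) x =
      convolution (η.normed volume) (Ω.indicator G) (ContinuousLinearMap.lsmul ℝ ℝ) volume x := by
  set w := η.normed (volume : Measure (EuclideanSpace ℝ (Fin N))) with hw
  have hwc : ContDiff ℝ ∞ w := η.contDiff_normed
  have hws : HasCompactSupport w := η.hasCompactSupport_normed
  -- The mollification at `x` is an integral against this reflected kernel, which is admissible in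
  -- the definition of the weak gradient because its support lies in the ball assumed to be inside
  -- `Ω`.
  set φ : EuclideanSpace ℝ (Fin N) → ℝ := fun y => w (x - y) with hφ
  have hφs : Function.support φ ⊆ Metric.closedBall x η.rOut := by
    intro y hy
    have : x - y ∈ Function.support w := hy
    rw [hw, η.support_normed_eq] at this
    rw [Metric.mem_closedBall, dist_comm, dist_eq_norm]
    exact (mem_ball_zero_iff.1 this).le
  have hφt : tsupport φ ⊆ Metric.closedBall x η.rOut :=
    closure_minimal hφs Metric.isClosed_closedBall
  have hφ_test : IsTestFunction Ω φ := by
    refine ⟨hwc.comp (contDiff_const.sub contDiff_id), ?_, hφt.trans hx⟩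
    exact HasCompactSupport.of_support_subset_isCompact (isCompact_closedBall _ _) hφs
  have hgrad : ∀ y i, gradient φ y i = - fderiv ℝ w (x - y) (EuclideanSpace.single i 1) := by
    intro y i
    rw [gradient_apply_eq_fderiv]
    have h1 : HasFDerivAt φ ((fderiv ℝ w (x - y)).comp
        (-ContinuousLinearMap.id ℝ (EuclideanSpace ℝ (Fin N)))) y := by
      have h2 : HasFDerivAt (fun y => x - y)
        (-ContinuousLinearMap.id ℝ (EuclideanSpace ℝ (Fin N))) y := (hasFDerivAt_id y).const_sub x
      exact ((hwc.differentiable (by simp)) (x - y)).hasFDerivAt.comp y h2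
    rw [h1.fderiv]
    simp
  ext i
  rw [gradient_apply_eq_fderiv,
    (hws.hasFDerivAt_convolution_left (ContinuousLinearMap.lsmul ℝ ℝ)
      (hwc.of_le (by exact_mod_cast le_top)) hũ x).fderiv]
  have hGl : LocallyIntegrable (Ω.indicator G) volume :=
    (hGi.integrable_indicator hΩ).locallyIntegrable
  have hex1 : Integrable (fun t => (ContinuousLinearMap.precompL (EuclideanSpace ℝ (Fin N))
      (ContinuousLinearMap.lsmul ℝ ℝ)) (fderiv ℝ w t) (ũ (x - t))) volume :=
    (hws.fderiv ℝ).convolutionExists_left _ (hwc.continuous_fderiv (by simp)) hũ x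
  have hex2 : Integrable (fun t => (ContinuousLinearMap.lsmul ℝ ℝ) (w t)
      ((Ω.indicator G) (x - t))) volume :=
    hws.convolutionExists_left (ContinuousLinearMap.lsmul ℝ ℝ) hwc.continuous hGl x
  rw [convolution_def, convolution_def, ContinuousLinearMap.integral_apply hex1]
  have e2 : (∫ t, (ContinuousLinearMap.lsmul ℝ ℝ) (w t) ((Ω.indicator G) (x - t))) i =
      ∫ t, w t * (Ω.indicator G) (x - t) i := by
    have := (EuclideanSpace.proj (𝕜 := ℝ) i).integral_comp_comm hex2
    simpa using this.symm
  rw [e2]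
  have key := hG.2.2 φ hφ_test i
  rw [← integral_sub_left_eq_self _ volume x, ← integral_sub_left_eq_self
    (fun t => w t * (Ω.indicator G) (x - t) i) volume x]
  simp only [sub_sub_cancel]
  calc ∫ y, (ContinuousLinearMap.precompL (EuclideanSpace ℝ (Fin N))
      (ContinuousLinearMap.lsmul ℝ ℝ)) (fderiv ℝ w (x - y)) (ũ y) (EuclideanSpace.single i 1)
      = ∫ y in Ω, -(u y * gradient φ y i) := by
        rw [← setIntegral_eq_integral_of_forall_compl_eq_zero (s := Ω)]
        · refine setIntegral_congr_fun hΩ fun y hy => ?_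
          simp [hgrad, hũu y hy, ContinuousLinearMap.precompL_apply]
          ring
        · intro y hy
          have h0 : gradient φ y = 0 :=
            gradient_eq_zero_of_notMem_tsupport fun h => hy (hx (hφt h))
          have h1 := hgrad y i
          rw [h0] at h1
          have h2 : fderiv ℝ w (x - y) (EuclideanSpace.single i 1) = 0 := by
            simpa using h1.symm
          simp [ContinuousLinearMap.precompL_apply, h2]
    _ = ∫ y in Ω, G y i * φ y := by rw [integral_neg, key, neg_neg]
    _ = ∫ y, w (x - y) * (Ω.indicator G) y i := by
        rw [← setIntegral_eq_integral_of_forall_compl_eq_zero (s := Ω)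
          (f := fun y => w (x - y) * (Ω.indicator G) y i)]
        · refine setIntegral_congr_fun hΩ fun y hy => ?_
          simp [hy, hφ, mul_comm]
        · intro y hy
          rw [Set.indicator_of_notMem hy]
          simp

/-- An average of values at least `m` is at least `m`. This keeps the mollified function above the
barrier wherever the barrier is at most `m`. -/
theorem le_convolution_normed {m : ℝ} {ũ : EuclideanSpace ℝ (Fin N) → ℝ}
    (hũ : LocallyIntegrable ũ volume) (hm : ∀ᵐ x, m ≤ ũ x)
    (η : ContDiffBump (0 : EuclideanSpace ℝ (Fin N))) (x : EuclideanSpace ℝ (Fin N)) :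
    m ≤ convolution (η.normed volume) ũ (ContinuousLinearMap.lsmul ℝ ℝ) volume x := by
  have i1 : Integrable (fun t => η.normed volume t • ũ (x - t)) volume :=
    (η.hasCompactSupport_normed.convolutionExists_left (ContinuousLinearMap.lsmul ℝ ℝ)
      η.continuous_normed hũ x)
  have i2 : Integrable (fun t => η.normed volume t • m) volume :=
    η.integrable_normed.smul_const _
  have e : ∫ t, η.normed volume t • m = m := by
    rw [integral_smul_const, η.integral_normed, one_smul]
  calc m = ∫ t, η.normed volume t • m := e.symm
    _ ≤ ∫ t, η.normed volume t • ũ (x - t) := by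
      refine integral_mono_ae i2 i1 ?_
      filter_upwards [(quasiMeasurePreserving_sub_left volume x).ae hm] with t ht
      exact mul_le_mul_of_nonneg_left ht (η.nonneg_normed t)

/-- A Poincaré inequality in `L¹`. -/
theorem integral_le_mul_integral_norm_gradient {Ω : Set (EuclideanSpace ℝ (Fin N))} (hN : 0 < N)
    {D : ℝ} (hΩ : MeasurableSet Ω) (hD : ∀ x ∈ Ω, ‖x‖ ≤ D)
    {φ : EuclideanSpace ℝ (Fin N) → ℝ} (hφ : IsTestFunction Ω φ) :
    ∫ x in Ω, φ x ≤ D * ∫ x in Ω, ‖gradient φ x‖ := by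
  let i : Fin N := ⟨0, hN⟩
  let e : EuclideanSpace ℝ (Fin N) := EuclideanSpace.single i 1
  have hφ1 : ContDiff ℝ 1 φ := hφ.1.of_le (by exact_mod_cast le_top)
  have hgc := hφ1.continuous_gradient
  have hgs : HasCompactSupport (gradient φ) := by
    refine HasCompactSupport.intro hφ.2.1 fun x hx => gradient_eq_zero_of_notMem_tsupport hx
  have hgi : Continuous fun x => gradient φ x i := by fun_prop
  have hfd : ∀ x, fderiv ℝ (fun y : EuclideanSpace ℝ (Fin N) => y i) x e = 1 := fun x => by
    have : HasFDerivAt (fun y : EuclideanSpace ℝ (Fin N) => y i)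
      (EuclideanSpace.proj (𝕜 := ℝ) i) x := (EuclideanSpace.proj (𝕜 := ℝ) i).hasFDerivAt
    rw [this.fderiv]
    simp [e]
  have hxi : Continuous fun x : EuclideanSpace ℝ (Fin N) => x i := by fun_prop
  -- Since `∂ᵢ xᵢ = 1`, integration by parts against one coordinate turns `∫ φ` into `-∫ xᵢ ∂ᵢφ`,
  -- and `|xᵢ| ≤ D` on `Ω`.
  have hibp := integral_mul_fderiv_eq_neg_fderiv_mul_of_integrable (μ := volume)
    (f := fun y : EuclideanSpace ℝ (Fin N) => y i) (g := φ) (v := e)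
    (by simpa only [hfd, one_mul] using hφ.1.continuous.integrable_of_hasCompactSupport hφ.2.1)
    (by
      simp only [e, ← gradient_apply_eq_fderiv]
      refine (hxi.mul hgi).integrable_of_hasCompactSupport ?_
      refine HasCompactSupport.intro hφ.2.1 fun x hx => ?_
      simp [gradient_eq_zero_of_notMem_tsupport hx])
    ((hxi.mul hφ.1.continuous).integrable_of_hasCompactSupport hφ.2.1.mul_left)
    (fun x _ => (EuclideanSpace.proj (𝕜 := ℝ) i).differentiableAt)
    (fun x _ => hφ.1.differentiable (by simp) x)
  simp only [hfd, one_mul] at hibp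
  have e1 : ∫ x in Ω, φ x = ∫ x, φ x :=
    setIntegral_eq_integral_of_forall_compl_eq_zero fun x hx =>
      image_eq_zero_of_notMem_tsupport fun h => hx (hφ.2.2 h)
  have e2 : ∫ x, x i * fderiv ℝ φ x e = ∫ x in Ω, x i * gradient φ x i := by
    simp only [e, ← gradient_apply_eq_fderiv]
    refine (setIntegral_eq_integral_of_forall_compl_eq_zero fun x hx => ?_).symm
    simp [gradient_eq_zero_of_notMem_tsupport fun h => hx (hφ.2.2 h)]
  rw [e1, ← neg_neg (∫ x, φ x), ← hibp, e2, ← integral_const_mul, ← integral_neg]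
  refine setIntegral_mono_on ?_ ?_ hΩ fun x hx => ?_
  · refine (((hxi.mul hgi).integrable_of_hasCompactSupport ?_).neg).integrableOn
    refine HasCompactSupport.intro hφ.2.1 fun x hx => ?_
    simp [gradient_eq_zero_of_notMem_tsupport hx]
  · exact ((hgc.norm.integrable_of_hasCompactSupport hgs.norm).const_mul D).integrableOn
  · have h1 : |x i| ≤ ‖x‖ := PiLp.norm_apply_le x i
    have h2 : |gradient φ x i| ≤ ‖gradient φ x‖ := PiLp.norm_apply_le (gradient φ x) i
    calc -(x i * gradient φ x i) ≤ |x i * gradient φ x i| := neg_le_abs _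
      _ = |x i| * |gradient φ x i| := abs_mul _ _
      _ ≤ D * ‖gradient φ x‖ := by
        exact mul_le_mul (h1.trans (hD x hx)) h2 (abs_nonneg _)
          ((norm_nonneg x).trans (hD x hx))

end Gradient

/-! ### Weak comparison principle -/

theorem memLp_pFlux {N : ℕ} {p q : ℝ} (hp : 1 < p) (hpq : p.HolderConjugate q)
    {ν : Measure (EuclideanSpace ℝ (Fin N))}
    {G : EuclideanSpace ℝ (Fin N) → EuclideanSpace ℝ (Fin N)}
    (hG : MemLp G (ENNReal.ofReal p) ν) :
    MemLp (fun x => pFlux p (G x)) (ENNReal.ofReal q) ν := by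
  have hm : AEStronglyMeasurable (fun x => pFlux p (G x)) ν := by
    exact AEStronglyMeasurable.smul
      (hG.1.norm.aemeasurable.pow_const (p - 2)).aestronglyMeasurable hG.1
  have h := hG.norm_rpow_div (ENNReal.ofReal (p - 1))
  rw [ENNReal.toReal_ofReal (by linarith), ← ENNReal.ofReal_div_of_pos (by linarith)] at h
  -- As `(p - 1) q = p`, the flux has norm `‖G‖^{p-1}` in `L^q` and pairs with gradients in `L^p`.
  have hq : p / (p - 1) = q := hpq.conjugate_eq.symm
  rw [hq] at h
  refine h.mono hm (Eventually.of_forall fun x => ?_)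
  rw [norm_pFlux hp, Real.norm_of_nonneg (by positivity)]

theorem IsTestFunction.integrable_norm_gradient {N : ℕ} {Ω : Set (EuclideanSpace ℝ (Fin N))}
    {φ : EuclideanSpace ℝ (Fin N) → ℝ} (hφ : IsTestFunction Ω φ) :
    Integrable (fun x => ‖gradient φ x‖) := by
  have hφ1 : ContDiff ℝ 1 φ := hφ.1.of_le (by exact_mod_cast le_top)
  have hgs : HasCompactSupport (gradient φ) :=
    HasCompactSupport.intro hφ.2.1 fun x hx => gradient_eq_zero_of_notMem_tsupport hx
  exact hφ1.continuous_gradient.norm.integrable_of_hasCompactSupport hgs.norm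

/-- Weak comparison principle for the `p`-Laplacian: a smooth function `V` which is a weak
subsolution relative to `u` and lies below `m ≤ u` away from a ball inside `Ω` lies below `u`. -/
theorem weak_comparison {N : ℕ} (hN : 0 < N) {p R m : ℝ} (hp : 1 < p)
    {Ω : Set (EuclideanSpace ℝ (Fin N))} (hΩ : IsOpen Ω) (hΩb : Bornology.IsBounded Ω)
    (hR : Metric.closedBall 0 R ⊆ Ω)
    {u : EuclideanSpace ℝ (Fin N) → ℝ}
    {G : EuclideanSpace ℝ (Fin N) → EuclideanSpace ℝ (Fin N)}
    (hu : IntegrableOn u Ω) (hG : HasWeakGradient Ω u G)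
    (hGp : MemLp G (ENNReal.ofReal p) (volume.restrict Ω))
    (hum : ∀ᵐ x ∂(volume.restrict Ω), m ≤ u x)
    {V : EuclideanSpace ℝ (Fin N) → ℝ} (hV : ContDiff ℝ ∞ V) (hVm : ∀ x, R ≤ ‖x‖ → V x ≤ m)
    (hle : ∀ φ, IsTestFunction Ω φ → (∀ x, 0 ≤ φ x) →
      ∫ x in Ω, inner ℝ (pFlux p (gradient V x) - pFlux p (G x)) (gradient φ x) ≤ 0) :
    ∀ᵐ x ∂(volume.restrict Ω), V x ≤ u x := by
  classical
  obtain ⟨q, hpq⟩ : ∃ q, p.HolderConjugate q := ⟨_, Real.HolderConjugate.conjExponent hp⟩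
  have hΩm := hΩ.measurableSet
  have hfin : IsFiniteMeasure (volume.restrict Ω) := ⟨by
    rw [Measure.restrict_apply_univ]; exact hΩb.measure_lt_top⟩
  have hp1 : 1 ≤ ENNReal.ofReal p := by simpa using ENNReal.ofReal_le_ofReal hp.le
  have hq1 : 1 ≤ ENNReal.ofReal q := by simpa using ENNReal.ofReal_le_ofReal hpq.symm.lt.le
  -- room between the ball and the complement of `Ω`
  obtain ⟨δ, hδ, hthick⟩ : ∃ δ > 0, Metric.cthickening δ (Metric.closedBall 0 R) ⊆ Ω :=
    (isCompact_closedBall 0 R).exists_cthickening_subset_open hΩ hR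
  -- extension of `u` by `m`
  set ũ : EuclideanSpace ℝ (Fin N) → ℝ := Ω.piecewise u (fun _ => m) with hũdef
  have hũu : ∀ x ∈ Ω, ũ x = u x := fun x hx => Set.piecewise_eq_of_mem _ _ _ hx
  have hũl : LocallyIntegrable ũ volume := by
    have e : ũ = Ω.indicator u + Ωᶜ.indicator (fun _ => m) := by
      rw [hũdef]; exact (Set.indicator_add_compl_eq_piecewise u _).symm
    rw [e]
    exact ((integrable_indicator_iff hΩm).2 hu).locallyIntegrable.add
      ((locallyIntegrable_const m).indicator hΩm.compl)
  have hũm : ∀ᵐ x, m ≤ ũ x := by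
    filter_upwards [(ae_restrict_iff' hΩm).1 hum] with x hx
    by_cases h : x ∈ Ω
    · rw [hũu x h]; exact hx h
    · rw [hũdef, Set.piecewise_eq_of_notMem _ _ _ h]
  set Gt : EuclideanSpace ℝ (Fin N) → EuclideanSpace ℝ (Fin N) := Ω.indicator G with hGt
  have hGtp : MemLp Gt (ENNReal.ofReal p) volume := (memLp_indicator_iff_restrict hΩm).2 hGp
  have hGi : IntegrableOn G Ω := hGp.integrable hp1
  -- mollifiers
  let η : ℕ → ContDiffBump (0 : EuclideanSpace ℝ (Fin N)) := fun n =>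
    { rIn := δ / 2 * (1 / ((n : ℝ) + 1)), rOut := δ * (1 / ((n : ℝ) + 1))
      rIn_pos := by positivity
      rIn_lt_rOut := by
        have : 0 < 1 / ((n : ℝ) + 1) := by positivity
        nlinarith }
  have hη0 : Tendsto (fun n => (η n).rOut) atTop (𝓝 0) := by
    have := (tendsto_one_div_add_atTop_nhds_zero_nat (𝕜 := ℝ)).const_mul δ
    simpa [η] using this
  have hηδ : ∀ n, (η n).rOut ≤ δ := fun n => by
    have : 1 / ((n : ℝ) + 1) ≤ 1 := by
      rw [div_le_one (by positivity)]; linarith [(Nat.cast_nonneg n : (0 : ℝ) ≤ n)]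
    change δ * (1 / ((n : ℝ) + 1)) ≤ δ
    nlinarith
  set un : ℕ → EuclideanSpace ℝ (Fin N) → ℝ := fun n =>
    convolution ((η n).normed volume) ũ (ContinuousLinearMap.lsmul ℝ ℝ) volume with hun
  set gn : ℕ → EuclideanSpace ℝ (Fin N) → EuclideanSpace ℝ (Fin N) := fun n =>
    convolution ((η n).normed volume) Gt (ContinuousLinearMap.lsmul ℝ ℝ) volume with hgn
  have hunm : ∀ n x, m ≤ un n x := fun n x => le_convolution_normed hũl hũm (η n) x
  have hunc : ∀ n, ContDiff ℝ ∞ (un n) := fun n =>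
    (η n).hasCompactSupport_normed.contDiff_convolution_left _ (η n).contDiff_normed hũl
  have hgnc : ∀ n, Continuous (gn n) := fun n =>
    (η n).hasCompactSupport_normed.continuous_convolution_left _ (η n).continuous_normed
      (hGtp.locallyIntegrable hp1)
  -- The ratio `rOut / rIn` is fixed at `2`; this bounded eccentricity gives convergence at almost
  -- every point.
  have hunlim : ∀ᵐ x ∂(volume.restrict Ω), Tendsto (fun n => un n x) atTop (𝓝 (u x)) := by
    have h := ContDiffBump.ae_convolution_tendsto_right_of_locallyIntegrable (φ := η) (l := atTop)
      (K := 2) hη0 (Eventually.of_forall fun n => by simp only [η]; linarith) hũl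
    filter_upwards [ae_restrict_of_ae h, ae_restrict_mem hΩm] with x hx hxΩ
    rwa [hũu x hxΩ] at hx
  have hgnlim : Tendsto (fun n => eLpNorm (fun x => gn n x - G x) (ENNReal.ofReal p)
      (volume.restrict Ω)) atTop (𝓝 0) := by
    have h := tendsto_eLpNorm_convolution_sub volume hp.le hGtp (φ := η) hη0
    refine tendsto_of_tendsto_of_tendsto_of_le_of_le tendsto_const_nhds h (fun _ => zero_le)
      fun n => ?_
    refine le_trans (le_of_eq ?_) (eLpNorm_mono_measure _ (Measure.restrict_le_self (s := Ω)))
    refine eLpNorm_congr_ae ?_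
    filter_upwards [ae_restrict_mem hΩm] with x hx
    simp [gn, Gt, hx]
  have hgradun : ∀ n x, ‖x‖ ≤ R → gradient (un n) x = gn n x := fun n x hx => by
    refine gradient_convolution_eq hΩm hG hGi hũl hũu (η n) x ?_
    refine subset_trans ?_ hthick
    refine subset_trans (Metric.closedBall_subset_closedBall (hηδ n)) ?_
    exact Metric.closedBall_subset_cthickening (by simpa using hx) δ
  -- the test functions
  set φ : ℕ → EuclideanSpace ℝ (Fin N) → ℝ := fun n x => smoothPos (V x - un n x) with hφ
  set a : ℕ → EuclideanSpace ℝ (Fin N) → ℝ :=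
    fun n x => Real.smoothTransition (V x - un n x) with ha
  -- Outside the ball `V ≤ m ≤ un`, so the smoothed positive part of `V - un n` vanishes there and
  -- the test function is compactly supported in `Ω`.
  have hout : ∀ n x, R ≤ ‖x‖ → V x - un n x ≤ 0 := fun n x hx => by
    linarith [hVm x hx, hunm n x]
  have hφtest : ∀ n, IsTestFunction Ω (φ n) := fun n => by
    have hs : Function.support (φ n) ⊆ Metric.closedBall 0 R := fun x hx => by
      rw [mem_closedBall_zero_iff]
      by_contra h
      exact hx (smoothPos_of_nonpos (hout n x (not_le.1 h).le))
    exact ⟨contDiff_smoothPos.comp (hV.sub (hunc n)),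
      HasCompactSupport.of_support_subset_isCompact (isCompact_closedBall _ _) hs,
      (closure_minimal hs Metric.isClosed_closedBall).trans hR⟩
  have hφ0 : ∀ n x, 0 ≤ φ n x := fun n x => smoothPos_nonneg _
  -- Inside the ball the gradient of `un n` is `gn n`. Outside, the factor `a n` vanishes, so the
  -- formula holds everywhere although `gn n` need not be that gradient near the boundary of `Ω`.
  have hgradφ : ∀ n x, gradient (φ n) x = a n x • (gradient V x - gn n x) := fun n x => by
    have h1 : HasFDerivAt (φ n) (a n x • (fderiv ℝ V x - fderiv ℝ (un n) x)) x := by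
      have h2 := ((hV.differentiable (by simp) x).hasFDerivAt.sub
        ((hunc n).differentiable (by simp) x).hasFDerivAt)
      exact (hasDerivAt_smoothPos _).comp_hasFDerivAt x h2
    have h3 : gradient (φ n) x = a n x • (gradient V x - gradient (un n) x) := by
      simp only [gradient, h1.fderiv, map_smul, map_sub]
    rcases le_total ‖x‖ R with h | h
    · rw [h3, hgradun n x h]
    · have : a n x = 0 := Real.smoothTransition.zero_of_nonpos (hout n x h)
      rw [h3, this, zero_smul, zero_smul]
  -- integrability
  have hVg : Continuous (gradient V) := (hV.of_le (by exact_mod_cast le_top)).continuous_gradient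
  have hbdd : ∀ {F : Type} [NormedAddCommGroup F] (g : EuclideanSpace ℝ (Fin N) → F),
      Continuous g → ∀ r : ENNReal, MemLp g r (volume.restrict Ω) := by
    intro F _ g hg r
    obtain ⟨C, hC⟩ := (hΩb.isCompact_closure).exists_bound_of_continuousOn hg.continuousOn
    refine MemLp.of_bound hg.aestronglyMeasurable C ?_
    filter_upwards [ae_restrict_mem hΩm] with x hx using hC x (subset_closure hx)
  set W : EuclideanSpace ℝ (Fin N) → EuclideanSpace ℝ (Fin N) := fun x =>
    pFlux p (gradient V x) - pFlux p (G x) with hW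
  set d : EuclideanSpace ℝ (Fin N) → EuclideanSpace ℝ (Fin N) := fun x =>
    gradient V x - G x with hd
  have hWq : MemLp W (ENNReal.ofReal q) (volume.restrict Ω) :=
    (memLp_pFlux hp hpq (hbdd _ hVg _)).sub (memLp_pFlux hp hpq hGp)
  have hdp : MemLp d (ENNReal.ofReal p) (volume.restrict Ω) := (hbdd _ hVg _).sub hGp
  have hgnG : ∀ n, MemLp (fun x => gn n x - G x) (ENNReal.ofReal p) (volume.restrict Ω) :=
    fun n => (hbdd _ (hgnc n) _).sub hGp
  have hholder : ∀ (h : EuclideanSpace ℝ (Fin N) → EuclideanSpace ℝ (Fin N)),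
      MemLp h (ENNReal.ofReal p) (volume.restrict Ω) →
        Integrable (fun x => ‖W x‖ * ‖h x‖) (volume.restrict Ω) := fun h hh => by
    have := hpq.symm.ennrealOfReal
    exact hWq.norm.integrable_mul hh.norm
  have ha0 : ∀ n x, 0 ≤ a n x := fun n x => Real.smoothTransition.nonneg _
  have ha1 : ∀ n x, a n x ≤ 1 := fun n x => Real.smoothTransition.le_one _
  have hac : ∀ n, Continuous (a n) := fun n =>
    Real.smoothTransition.continuous.comp (hV.continuous.sub (hunc n).continuous)
  have hIW : ∀ n (h : EuclideanSpace ℝ (Fin N) → EuclideanSpace ℝ (Fin N)),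
      MemLp h (ENNReal.ofReal p) (volume.restrict Ω) →
        Integrable (fun x => a n x * inner ℝ (W x) (h x)) (volume.restrict Ω) := fun n h hh => by
    refine (hholder h hh).mono'
      ((hac n).aestronglyMeasurable.mul (hWq.1.inner hh.1)) (Eventually.of_forall fun x => ?_)
    rw [norm_mul, Real.norm_of_nonneg (ha0 n x)]
    calc a n x * ‖inner ℝ (W x) (h x)‖ ≤ 1 * (‖W x‖ * ‖h x‖) := by
          gcongr
          · exact ha1 n x
          · exact norm_inner_le_norm _ _
      _ = _ := one_mul _
  have hτ : Tendsto (fun n => ∫ x in Ω, ‖W x‖ * ‖gn n x - G x‖) atTop (𝓝 0) :=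
    tendsto_integral_norm_mul_norm hpq hWq hgnG hgnlim
  have hτ1 : Tendsto (fun n => ∫ x in Ω, ‖gn n x - G x‖) atTop (𝓝 0) := by
    have := tendsto_integral_norm_mul_norm hpq (W := fun _ => (1 : ℝ)) (memLp_const _) hgnG hgnlim
    simpa using this
  -- first limit
  have hineq : ∀ n, ∫ x in Ω, a n x * inner ℝ (W x) (d x) ≤
      ∫ x in Ω, ‖W x‖ * ‖gn n x - G x‖ := fun n => by
    have h1 := hle (φ n) (hφtest n) (hφ0 n)
    have h2 : ∀ x, inner ℝ (W x) (gradient (φ n) x) =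
        a n x * inner ℝ (W x) (d x) - a n x * inner ℝ (W x) (gn n x - G x) := fun x => by
      rw [hgradφ, real_inner_smul_right, ← mul_sub, ← inner_sub_right]
      simp only [hd]
      congr 2
      abel
    have h3 : ∫ x in Ω, inner ℝ (W x) (gradient (φ n) x) ≤ 0 := h1
    simp only [h2] at h3
    rw [integral_sub (hIW n d hdp) (hIW n _ (hgnG n))] at h3
    have h4 : ∫ x in Ω, a n x * inner ℝ (W x) (gn n x - G x) ≤
        ∫ x in Ω, ‖W x‖ * ‖gn n x - G x‖ := by
      refine integral_mono (hIW n _ (hgnG n)) (hholder _ (hgnG n)) fun x => ?_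
      calc a n x * inner ℝ (W x) (gn n x - G x) ≤ 1 * (‖W x‖ * ‖gn n x - G x‖) := by
            refine (mul_le_mul_of_nonneg_left (real_inner_le_norm _ _) (ha0 n x)).trans ?_
            gcongr
            exact ha1 n x
        _ = _ := one_mul _
    linarith
  have halim : ∀ᵐ x ∂(volume.restrict Ω),
      Tendsto (fun n => a n x) atTop (𝓝 (Real.smoothTransition (V x - u x))) := by
    filter_upwards [hunlim] with x hx
    exact (Real.smoothTransition.continuous.tendsto _).comp (hx.const_sub (V x))
  have hlim1 : Tendsto (fun n => ∫ x in Ω, a n x * inner ℝ (W x) (d x)) atTop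
      (𝓝 (∫ x in Ω, Real.smoothTransition (V x - u x) * inner ℝ (W x) (d x))) := by
    refine tendsto_integral_of_dominated_convergence (fun x => ‖W x‖ * ‖d x‖)
      (fun n => (hIW n d hdp).1) (hholder d hdp) (fun n => Eventually.of_forall fun x => ?_) ?_
    · rw [norm_mul, Real.norm_of_nonneg (ha0 n x)]
      calc a n x * ‖inner ℝ (W x) (d x)‖ ≤ 1 * (‖W x‖ * ‖d x‖) := by
            gcongr
            · exact ha1 n x
            · exact norm_inner_le_norm _ _
        _ = _ := one_mul _
    · filter_upwards [halim] with x hx using hx.mul_const _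
  have hle0 : ∫ x in Ω, Real.smoothTransition (V x - u x) * inner ℝ (W x) (d x) ≤ 0 :=
    le_of_tendsto_of_tendsto' hlim1 hτ hineq
  have hVu : AEStronglyMeasurable (fun x => V x - u x) (volume.restrict Ω) :=
    hV.continuous.aestronglyMeasurable.sub hu.1
  have hsm : AEStronglyMeasurable (fun x => Real.smoothTransition (V x - u x))
      (volume.restrict Ω) :=
    Real.smoothTransition.continuous.comp_aestronglyMeasurable hVu
  have hnn : ∀ x, 0 ≤ Real.smoothTransition (V x - u x) * inner ℝ (W x) (d x) := fun x =>
    mul_nonneg (Real.smoothTransition.nonneg _) (inner_pFlux_sub_nonneg hp _ _)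
  have hint : Integrable (fun x => Real.smoothTransition (V x - u x) * inner ℝ (W x) (d x))
      (volume.restrict Ω) := by
    refine (hholder d hdp).mono' (hsm.mul (hWq.1.inner hdp.1)) (Eventually.of_forall fun x => ?_)
    rw [norm_mul, Real.norm_of_nonneg (Real.smoothTransition.nonneg _)]
    calc Real.smoothTransition (V x - u x) * ‖inner ℝ (W x) (d x)‖
        ≤ 1 * (‖W x‖ * ‖d x‖) := by
          gcongr
          · exact Real.smoothTransition.le_one _
          · exact norm_inner_le_norm _ _
      _ = _ := one_mul _
  -- A nonnegative integrand with nonpositive integral vanishes almost everywhere. Strict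
  -- monotonicity then gives `∇V = G` wherever the cutoff is nonzero.
  have hae : ∀ᵐ x ∂(volume.restrict Ω), Real.smoothTransition (V x - u x) * ‖d x‖ = 0 := by
    have h0 := (integral_eq_zero_iff_of_nonneg hnn hint).1
      (le_antisymm hle0 (integral_nonneg hnn))
    filter_upwards [h0] with x hx
    rcases mul_eq_zero.1 (show _ * _ = (0 : ℝ) from hx) with h | h
    · rw [h, zero_mul]
    · have : gradient V x = G x := eq_of_inner_pFlux_sub_le_zero hp h.le
      simp [hd, this]
  -- second limit
  obtain ⟨D, hD⟩ : ∃ D, ∀ x ∈ Ω, ‖x‖ ≤ D := by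
    obtain ⟨D, hD⟩ := hΩb.subset_closedBall 0
    exact ⟨D, fun x hx => by simpa using hD hx⟩
  have hD0 : 0 ≤ |D| := abs_nonneg D
  have hdi : Integrable (fun x => ‖d x‖) (volume.restrict Ω) := (hdp.integrable hp1).norm
  have hadi : ∀ n, Integrable (fun x => a n x * ‖d x‖) (volume.restrict Ω) := fun n => by
    refine hdi.mono ((hac n).aestronglyMeasurable.mul hdi.1) (Eventually.of_forall fun x => ?_)
    rw [norm_mul, Real.norm_of_nonneg (ha0 n x)]
    exact mul_le_of_le_one_left (norm_nonneg _) (ha1 n x)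
  have hlim2 : Tendsto (fun n => ∫ x in Ω, a n x * ‖d x‖) atTop (𝓝 0) := by
    have h0 : ∫ x in Ω, Real.smoothTransition (V x - u x) * ‖d x‖ = 0 :=
      integral_eq_zero_of_ae hae
    rw [← h0]
    refine tendsto_integral_of_dominated_convergence (fun x => ‖d x‖)
      (fun n => (hadi n).1) hdi (fun n => Eventually.of_forall fun x => ?_) ?_
    · rw [norm_mul, Real.norm_of_nonneg (ha0 n x), norm_norm]
      exact mul_le_of_le_one_left (norm_nonneg _) (ha1 n x)
    · filter_upwards [halim] with x hx using hx.mul_const _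
  -- Poincaré is applied to the smooth `φ n`, so no vanishing criterion for Sobolev functions is
  -- needed. Its gradient is controlled by two terms that both tend to zero in `L¹`.
  have hpoin : ∀ n, ∫ x in Ω, φ n x ≤
      |D| * ((∫ x in Ω, a n x * ‖d x‖) + ∫ x in Ω, ‖gn n x - G x‖) := fun n => by
    refine (integral_le_mul_integral_norm_gradient hN hΩm
      (fun x hx => (hD x hx).trans (le_abs_self D)) (hφtest n)).trans ?_
    have hi : Integrable (fun x => ‖gn n x - G x‖) (volume.restrict Ω) :=
      ((hgnG n).integrable hp1).norm
    rw [← integral_add (hadi n) hi]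
    refine mul_le_mul_of_nonneg_left ?_ hD0
    refine integral_mono (hφtest n).integrable_norm_gradient.integrableOn
      ((hadi n).add hi) fun x => ?_
    change ‖gradient (φ n) x‖ ≤ a n x * ‖d x‖ + ‖gn n x - G x‖
    have e : gradient (φ n) x = a n x • d x - a n x • (gn n x - G x) := by
      rw [hgradφ, ← smul_sub]
      congr 1
      simp only [hd]
      abel
    rw [e]
    refine (norm_sub_le _ _).trans ?_
    rw [norm_smul, norm_smul, Real.norm_of_nonneg (ha0 n x)]
    gcongr
    exact mul_le_of_le_one_left (norm_nonneg _) (ha1 n x)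
  -- The bound `un n ≥ m` and monotonicity make this one function dominate every `φ n`.
  have hψi : Integrable (fun x => smoothPos (V x - m)) (volume.restrict Ω) :=
    (hbdd (fun x => smoothPos (V x - m)) (contDiff_smoothPos.continuous.comp
      (hV.continuous.sub continuous_const)) 1).integrable le_rfl
  have hlim3 : Tendsto (fun n => ∫ x in Ω, φ n x) atTop
      (𝓝 (∫ x in Ω, smoothPos (V x - u x))) := by
    refine tendsto_integral_of_dominated_convergence (fun x => smoothPos (V x - m))
      (fun n => (hφtest n).1.continuous.aestronglyMeasurable)
      hψi (fun n => Eventually.of_forall fun x => ?_) ?_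
    · rw [Real.norm_of_nonneg (hφ0 n x)]
      exact monotone_smoothPos (by linarith [hunm n x])
    · filter_upwards [hunlim] with x hx
      exact (contDiff_smoothPos.continuous.tendsto _).comp (hx.const_sub (V x))
  have hle3 : ∫ x in Ω, smoothPos (V x - u x) ≤ 0 := by
    have := (hlim2.add hτ1).const_mul |D|
    rw [add_zero, mul_zero] at this
    exact le_of_tendsto_of_tendsto' hlim3 this hpoin
  have hint3 : Integrable (fun x => smoothPos (V x - u x)) (volume.restrict Ω) := by
    refine hψi.mono' (contDiff_smoothPos.continuous.comp_aestronglyMeasurable hVu) ?_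
    filter_upwards [hum] with x hx
    rw [Real.norm_of_nonneg (smoothPos_nonneg _)]
    exact monotone_smoothPos (by linarith)
  have h0 := (integral_eq_zero_iff_of_nonneg (fun x => smoothPos_nonneg (V x - u x)) hint3).1
    (le_antisymm hle3 (integral_nonneg fun x => smoothPos_nonneg _))
  filter_upwards [h0] with x hx
  by_contra hc
  exact (smoothPos_pos (sub_pos.2 (not_le.1 hc))).ne' hx

/-! ### Powers and slope of the smooth transition -/

section SmoothTransition

/-- Raising `exp(-1/t)` to the power `r` only rescales `t`. -/
theorem expNegInvGlue_rpow {r : ℝ} (hr : 0 < r) (t : ℝ) :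
    expNegInvGlue t ^ r = expNegInvGlue (t / r) := by
  rcases le_or_gt t 0 with h | h
  · rw [expNegInvGlue.zero_of_nonpos h, Real.zero_rpow hr.ne',
      expNegInvGlue.zero_of_nonpos (div_nonpos_of_nonpos_of_nonneg h hr.le)]
  · have h2 : 0 < t / r := by positivity
    simp only [expNegInvGlue, h.not_ge, h2.not_ge, if_false]
    rw [← Real.exp_mul, inv_div]
    congr 1
    field_simp

/-- The barrier needs the power `1/(p-1)` of a cutoff to be smooth even where the cutoff vanishes.
The numerator's power is again a glue function, and the denominator never vanishes. -/
theorem contDiff_smoothTransition_rpow {r : ℝ} (hr : 0 < r) :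
    ContDiff ℝ ∞ fun t => Real.smoothTransition t ^ r := by
  have e : (fun t => Real.smoothTransition t ^ r) = fun t =>
      expNegInvGlue (t / r) / (expNegInvGlue t + expNegInvGlue (1 - t)) ^ r := by
    ext t
    rw [Real.smoothTransition, Real.div_rpow (expNegInvGlue.nonneg _)
      (Real.smoothTransition.pos_denom t).le, expNegInvGlue_rpow hr]
  rw [e]
  have h : ContDiff ℝ ∞ expNegInvGlue := expNegInvGlue.contDiff
  refine (h.comp (contDiff_id.div_const r)).div ?_ fun t =>
    (Real.rpow_pos_of_pos (Real.smoothTransition.pos_denom t) r).ne'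
  exact (h.add (h.comp (contDiff_const.sub contDiff_id))).rpow_const_of_ne
    fun t => (Real.smoothTransition.pos_denom t).ne'

theorem exists_deriv_smoothTransition_le :
    ∃ L : ℝ, 0 < L ∧ ∀ t, deriv Real.smoothTransition t ≤ L := by
  have hc : Continuous (deriv Real.smoothTransition) :=
    (Real.smoothTransition.contDiff (n := 1)).continuous_deriv le_rfl
  have hs : HasCompactSupport (deriv Real.smoothTransition) := by
    refine HasCompactSupport.intro (isCompact_Icc (a := (0 : ℝ)) (b := 1)) fun t ht => ?_
    rcases lt_or_ge t 0 with h | h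
    · have : Real.smoothTransition =ᶠ[𝓝 t] fun _ => 0 := by
        filter_upwards [gt_mem_nhds h] with s hs
        exact Real.smoothTransition.zero_of_nonpos (le_of_lt hs)
      rw [this.deriv_eq, deriv_const]
    · have h1 : 1 < t := by
        by_contra hc
        exact ht ⟨h, not_lt.1 hc⟩
      have : Real.smoothTransition =ᶠ[𝓝 t] fun _ => 1 := by
        filter_upwards [lt_mem_nhds h1] with s hs
        exact Real.smoothTransition.one_of_one_le (le_of_lt hs)
      rw [this.deriv_eq, deriv_const]
  obtain ⟨C, hC⟩ := hs.exists_bound_of_continuous hc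
  exact ⟨|C| + 1, by positivity, fun t =>
    (le_abs_self _).trans ((hC t).trans ((le_abs_self C).trans (by linarith)))⟩

end SmoothTransition

/-! ### Radial functions in the variable log |x| -/

section LogRadial

variable {N : ℕ}

open Classical in
/-- The radial function `f (log |x|)`, where `f` is constant to the left of `T`. -/
noncomputable def logRadial (T : ℝ) (f : ℝ → ℝ) (x : EuclideanSpace ℝ (Fin N)) : ℝ :=
  if x = 0 then f T else f (Real.log ‖x‖)

theorem logRadial_of_ne {T : ℝ} {f : ℝ → ℝ} {x : EuclideanSpace ℝ (Fin N)} (hx : x ≠ 0) :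
    logRadial T f x = f (Real.log ‖x‖) := if_neg hx

theorem logRadial_eventuallyEq_zero {T : ℝ} {f : ℝ → ℝ} (hc : ∀ t ≤ T, f t = f T) :
    logRadial T f =ᶠ[𝓝 (0 : EuclideanSpace ℝ (Fin N))] fun _ => f T := by
  filter_upwards [Metric.ball_mem_nhds _ (Real.exp_pos T)] with x hx
  rcases eq_or_ne x 0 with h | h
  · simp [logRadial, h]
  · rw [logRadial_of_ne h]
    refine hc _ ?_
    rw [Real.log_le_iff_le_exp (norm_pos_iff.2 h)]
    exact (mem_ball_zero_iff.1 hx).le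

theorem logRadial_eventuallyEq_of_ne {T : ℝ} {f : ℝ → ℝ} {x : EuclideanSpace ℝ (Fin N)}
    (hx : x ≠ 0) : logRadial T f =ᶠ[𝓝 x] fun y => f (Real.log ‖y‖) := by
  filter_upwards [isOpen_ne.mem_nhds hx] with y hy using logRadial_of_ne hy

theorem contDiff_logRadial {T : ℝ} {f : ℝ → ℝ} (hf : ContDiff ℝ ∞ f) (hc : ∀ t ≤ T, f t = f T) :
    ContDiff ℝ ∞ (logRadial T f : EuclideanSpace ℝ (Fin N) → ℝ) := by
  rw [contDiff_iff_contDiffAt]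
  intro x
  rcases eq_or_ne x 0 with rfl | h
  · exact contDiffAt_const.congr_of_eventuallyEq (logRadial_eventuallyEq_zero hc)
  · refine ContDiffAt.congr_of_eventuallyEq ?_ (logRadial_eventuallyEq_of_ne h)
    exact hf.contDiffAt.comp x ((contDiffAt_norm ℝ h).log (norm_ne_zero_iff.2 h))

theorem gradient_logRadial_zero {T : ℝ} {f : ℝ → ℝ} (hc : ∀ t ≤ T, f t = f T) :
    gradient (logRadial T f : EuclideanSpace ℝ (Fin N) → ℝ) 0 = 0 := by
  rw [gradient, (logRadial_eventuallyEq_zero hc).fderiv_eq]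
  simp

theorem gradient_logRadial {T : ℝ} {f : ℝ → ℝ} {f' : ℝ} {x : EuclideanSpace ℝ (Fin N)}
    (hx : x ≠ 0) (hf : HasDerivAt f f' (Real.log ‖x‖)) :
    gradient (logRadial T f) x = (f' / ‖x‖ ^ 2) • x := by
  have h0 : 0 < ‖x‖ := norm_pos_iff.2 hx
  have h1 : HasFDerivAt (fun y : EuclideanSpace ℝ (Fin N) => ‖y‖ ^ 2) (2 • innerSL ℝ x) x :=
    (hasStrictFDerivAt_norm_sq x).hasFDerivAt
  -- `log ‖y‖` is written as half of `log ‖y‖²`, whose derivative is explicit.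
  have h2 := (h1.log (by positivity)).const_mul (1 / 2 : ℝ)
  have h3 : HasDerivAt f f' ((1 / 2 : ℝ) * Real.log (‖x‖ ^ 2)) := by
    convert hf using 1
    rw [Real.log_pow]
    push_cast
    ring
  have h4 := h3.comp_hasFDerivAt x h2
  have h5 : logRadial T f =ᶠ[𝓝 x] (f ∘ fun y => (1 / 2 : ℝ) * Real.log (‖y‖ ^ 2)) := by
    refine (logRadial_eventuallyEq_of_ne hx).trans (Eventually.of_forall fun y => ?_)
    simp only [Function.comp]
    rw [Real.log_pow]
    congr 1
    push_cast
    ring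
  rw [gradient, h5.fderiv_eq, h4.fderiv]
  apply (InnerProductSpace.toDual ℝ (EuclideanSpace ℝ (Fin N))).injective
  rw [LinearIsometryEquiv.apply_symm_apply]
  ext y
  simp only [InnerProductSpace.toDual_apply_apply, real_inner_smul_left]
  simp
  field_simp

/-- The divergence theorem for the field `b(x) x`. -/
theorem integral_mul_inner_gradient {b φ : EuclideanSpace ℝ (Fin N) → ℝ} (hb : ContDiff ℝ 1 b)
    (hφ : ContDiff ℝ 1 φ) (hs : HasCompactSupport φ) :
    ∫ x, b x * inner ℝ x (gradient φ x) =
      -∫ x, (N * b x + inner ℝ (gradient b x) x) * φ x := by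
  have hgs : HasCompactSupport (gradient φ) :=
    HasCompactSupport.intro hs fun x hx => gradient_eq_zero_of_notMem_tsupport hx
  have hxi : ∀ i, Continuous fun x : EuclideanSpace ℝ (Fin N) => x i := fun i => by fun_prop
  have hgφ : ∀ i, Continuous fun x => gradient φ x i := fun i => by
    have := hφ.continuous_gradient
    fun_prop
  have hgb : ∀ i, Continuous fun x => gradient b x i := fun i => by
    have := hb.continuous_gradient
    fun_prop
  have hd : ∀ i x, fderiv ℝ (fun y : EuclideanSpace ℝ (Fin N) => b y * y i) x
      (EuclideanSpace.single i 1) = b x + gradient b x i * x i := fun i x => by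
    have h1 : HasFDerivAt (fun y : EuclideanSpace ℝ (Fin N) => y i)
      (EuclideanSpace.proj (𝕜 := ℝ) i) x := (EuclideanSpace.proj (𝕜 := ℝ) i).hasFDerivAt
    have h2 : HasFDerivAt (fun y : EuclideanSpace ℝ (Fin N) => b y * y i)
        (b x • EuclideanSpace.proj (𝕜 := ℝ) i + x i • fderiv ℝ b x) x :=
      (hb.differentiable one_ne_zero x).hasFDerivAt.mul h1
    rw [h2.fderiv]
    simp [gradient_apply_eq_fderiv]
    ring
  have hI1 : ∀ i, Integrable fun x => b x * x i * gradient φ x i := fun i =>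
    ((hb.continuous.mul (hxi i)).mul (hgφ i)).integrable_of_hasCompactSupport
      (HasCompactSupport.intro hs fun x hx => by
        simp [gradient_eq_zero_of_notMem_tsupport hx])
  have hI2 : ∀ i, Integrable fun x => (b x + gradient b x i * x i) * φ x := fun i =>
    ((hb.continuous.add ((hgb i).mul (hxi i))).mul hφ.continuous).integrable_of_hasCompactSupport
      hs.mul_left
  have hibp : ∀ i, ∫ x, b x * x i * gradient φ x i =
      -∫ x, (b x + gradient b x i * x i) * φ x := fun i => by
    have := integral_mul_fderiv_eq_neg_fderiv_mul_of_integrable (μ := volume)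
      (f := fun y : EuclideanSpace ℝ (Fin N) => b y * y i) (g := φ)
      (v := EuclideanSpace.single i 1)
      (by simpa only [hd] using hI2 i)
      (by simpa only [← gradient_apply_eq_fderiv] using hI1 i)
      (((hb.continuous.mul (hxi i)).mul hφ.continuous).integrable_of_hasCompactSupport
        hs.mul_left)
      (fun x _ => (hb.differentiable one_ne_zero x).mul
        (EuclideanSpace.proj (𝕜 := ℝ) i).differentiableAt)
      (fun x _ => hφ.differentiable one_ne_zero x)
    simpa only [hd, ← gradient_apply_eq_fderiv] using this
  have e1 : ∀ x, b x * inner ℝ x (gradient φ x) = ∑ i, b x * x i * gradient φ x i := fun x => by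
    rw [PiLp.inner_apply, Finset.mul_sum]
    refine Finset.sum_congr rfl fun i _ => ?_
    simp
    ring
  have e2 : ∀ x, (N * b x + inner ℝ (gradient b x) x) * φ x =
      ∑ i, (b x + gradient b x i * x i) * φ x := fun x => by
    rw [← Finset.sum_mul, Finset.sum_add_distrib, PiLp.inner_apply]
    simp [mul_comm]
  simp only [e1, e2]
  rw [integral_finsetSum _ fun i _ => hI1 i, integral_finsetSum _ fun i _ => hI2 i,
    ← Finset.sum_neg_distrib]
  exact Finset.sum_congr rfl fun i _ => hibp i

end LogRadial

/-! ### Construction of the barrier -/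

/-- A smooth bounded strict subsolution of `-Δ_p V = lam |x|^{-p} V^{p-1}` that agrees with
`m (R/|x|)^a` for `|x| ≥ r`; the divergence of `-|∇V|^{p-2} ∇V` is the continuous function `g`. -/
theorem exists_barrier {N : ℕ} {p a c lam m R r : ℝ} (hp : 1 < p) (ha : 0 < a)
    (hc : ∀ b ∈ Icc 0 a, b ^ (p - 1) * (N - p - (p - 1) * b) ≤ c) (hclam : c < lam)
    (hm : 0 < m) (hr : 0 < r) (hrR : r ≤ R) :
    ∃ V g : EuclideanSpace ℝ (Fin N) → ℝ, ContDiff ℝ ∞ V ∧ (∀ x, 0 < V x) ∧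
      (∃ M, ∀ x, V x ≤ M) ∧ (∀ x, r ≤ ‖x‖ → V x = m * (R / ‖x‖) ^ a) ∧ Continuous g ∧
      (∀ φ, ContDiff ℝ 1 φ → HasCompactSupport φ →
        ∫ x, inner ℝ (pFlux p (gradient V x)) (gradient φ x) = ∫ x, g x * φ x) ∧
      ∀ x, x ≠ 0 → g x ≤ lam * ‖x‖ ^ (-p) * V x ^ (p - 1) := by
  obtain ⟨L, hL, hLd⟩ := exists_deriv_smoothTransition_le
  have hp1 : 0 < p - 1 := by linarith
  have hap : 0 < a ^ (p - 1) := Real.rpow_pos_of_pos ha _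
  -- The transition is made so slow in `log |x|` that the derivative of `S` stays within the gap
  -- `lam - c`.
  obtain ⟨ε, hε, hεL⟩ : ∃ ε : ℝ, 0 < ε ∧ a ^ (p - 1) * (ε * L) ≤ lam - c := by
    refine ⟨(lam - c) / (a ^ (p - 1) * L), div_pos (sub_pos.2 hclam) (by positivity), ?_⟩
    field_simp
    exact le_rfl
  have hR : 0 < R := hr.trans_le hrR
  set T₁ := Real.log r with hT₁
  -- The transition occupies the interval of length `1/ε` to the left of `log r`.
  set T := T₁ - 1 / ε with hT
  set χ : ℝ → ℝ := fun t => Real.smoothTransition (ε * (t - T)) with hχ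
  have hχ0 : ∀ t, 0 ≤ χ t := fun t => Real.smoothTransition.nonneg _
  have hχ1 : ∀ t, χ t ≤ 1 := fun t => Real.smoothTransition.le_one _
  have hχT : ∀ t ≤ T, χ t = 0 := fun t ht =>
    Real.smoothTransition.zero_of_nonpos (by nlinarith)
  have hχT₁ : ∀ t, T₁ ≤ t → χ t = 1 := fun t ht => Real.smoothTransition.one_of_one_le (by
    have : 1 / ε ≤ t - T := by rw [hT]; linarith
    have := mul_le_mul_of_nonneg_left this hε.le
    rwa [mul_one_div_cancel hε.ne'] at this)
  have hlin : ContDiff ℝ ∞ fun t : ℝ => ε * (t - T) :=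
    contDiff_const.mul (contDiff_id.sub contDiff_const)
  have hlin' : ∀ t : ℝ, HasDerivAt (fun t : ℝ => ε * (t - T)) ε t := fun t => by
    simpa using ((hasDerivAt_id t).sub_const T).const_mul ε
  -- `α` is the local exponent of decay of `V`, rising from `0` near the origin to `a` at `|x| = r`.
  -- The root makes `α^{p-1}` exactly `a^{p-1} χ`, so the flux is smooth too.
  set α : ℝ → ℝ := fun t => a * χ t ^ (1 / (p - 1)) with hα
  have hα0 : ∀ t, 0 ≤ α t := fun t => mul_nonneg ha.le (Real.rpow_nonneg (hχ0 t) _)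
  have hαa : ∀ t, α t ≤ a := fun t =>
    mul_le_of_le_one_right ha.le (Real.rpow_le_one (hχ0 t) (hχ1 t) (by positivity))
  have hαT : ∀ t ≤ T, α t = 0 := fun t ht => by
    simp only [hα]
    rw [hχT t ht, Real.zero_rpow (by positivity), mul_zero]
  have hαT₁ : ∀ t, T₁ ≤ t → α t = a := fun t ht => by
    simp only [hα]
    rw [hχT₁ t ht, Real.one_rpow, mul_one]
  have hαc : ContDiff ℝ ∞ α :=
    contDiff_const.mul ((contDiff_smoothTransition_rpow (by positivity)).comp hlin)
  set S : ℝ → ℝ := fun t => a ^ (p - 1) * χ t with hS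
  have hαS : ∀ t, α t ^ (p - 1) = S t := fun t => by
    simp only [hα, hS]
    rw [Real.mul_rpow ha.le (Real.rpow_nonneg (hχ0 t) _), ← Real.rpow_mul (hχ0 t),
      one_div_mul_cancel hp1.ne', Real.rpow_one]
  have hSc : ContDiff ℝ ∞ S := contDiff_const.mul (Real.smoothTransition.contDiff.comp hlin)
  have hSd : ∀ t, HasDerivAt S
      (a ^ (p - 1) * (deriv Real.smoothTransition (ε * (t - T)) * ε)) t := fun t => by
    have h1 : HasDerivAt Real.smoothTransition (deriv Real.smoothTransition (ε * (t - T)))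
        (ε * (t - T)) :=
      ((Real.smoothTransition.contDiff (n := 1)).differentiable one_ne_zero _).hasDerivAt
    exact (h1.comp t (hlin' t)).const_mul _
  -- Starting the integral at `log R` normalises `V` to equal `m` on `|x| = R`.
  set H : ℝ → ℝ := fun t => - ∫ s in (Real.log R)..t, α s with hH
  have hHd : ∀ t, HasDerivAt H (- α t) t := fun t =>
    (intervalIntegral.integral_hasDerivAt_right (hαc.continuous.intervalIntegrable _ _)
      (hαc.continuous.stronglyMeasurableAtFilter _ _) hαc.continuous.continuousAt).neg
  have hHc : ContDiff ℝ ∞ H := by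
    rw [contDiff_infty_iff_deriv]
    refine ⟨fun t => (hHd t).differentiableAt, ?_⟩
    rw [show deriv H = fun t => - α t from funext fun t => (hHd t).deriv]
    exact hαc.neg
  have hHanti : Antitone H :=
    antitone_of_hasDerivAt_nonpos hHd fun t => neg_nonpos.2 (hα0 t)
  have hHT : ∀ t ≤ T, H t = H T := fun t ht => by
    have h1 : ∫ s in t..T, α s = 0 := by
      rw [intervalIntegral.integral_of_le ht]
      exact setIntegral_eq_zero_of_forall_eq_zero fun s hs => hαT s hs.2
    have h2 := intervalIntegral.integral_add_adjacent_intervals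
      (hαc.continuous.intervalIntegrable (Real.log R) t (μ := volume))
      (hαc.continuous.intervalIntegrable t T)
    rw [h1, add_zero] at h2
    simp only [hH, h2]
  have hHle : ∀ t, H t ≤ H T := fun t => by
    rcases le_total t T with h | h
    · exact (hHT t h).le
    · exact hHanti h
  have hHT₁ : ∀ t, T₁ ≤ t → H t = a * (Real.log R - t) := fun t ht => by
    have h1 : ∫ s in (Real.log R)..t, α s = ∫ s in (Real.log R)..t, a := by
      refine intervalIntegral.integral_congr fun s hs => hαT₁ s ?_
      exact (le_min (Real.log_le_log hr hrR) ht).trans hs.1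
    simp only [hH]
    rw [h1, intervalIntegral.integral_const, smul_eq_mul]
    ring
  set v : ℝ → ℝ := fun t => m * Real.exp (H t) with hv
  have hvc : ContDiff ℝ ∞ v := contDiff_const.mul hHc.exp
  have hvT : ∀ t ≤ T, v t = v T := fun t ht => by simp only [hv, hHT t ht]
  have hvd : ∀ t, HasDerivAt v (-(v t * α t)) t := fun t => by
    refine ((hHd t).exp.const_mul m).congr_deriv ?_
    simp only [hv]
    ring
  have hvpos : ∀ t, 0 < v t := fun t => by positivity
  -- At `t = log |x|` this is `α^{p-1} v^{p-1} |x|^{-p}`, the coefficient in `|∇V|^{p-2} ∇V = -B(log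
  -- |x|) x`.
  set B : ℝ → ℝ := fun t => S t * (m ^ (p - 1) * Real.exp ((p - 1) * H t - p * t)) with hB
  have hBc : ContDiff ℝ ∞ B := hSc.mul (contDiff_const.mul
    ((contDiff_const.mul hHc).sub (contDiff_const.mul contDiff_id)).exp)
  have hBT : ∀ t ≤ T, B t = B T := fun t ht => by
    simp only [hB, hS, hχT t ht, hχT T le_rfl]
    ring
  have hBd : ∀ t, HasDerivAt B
      (m ^ (p - 1) * Real.exp ((p - 1) * H t - p * t) *
        (a ^ (p - 1) * (deriv Real.smoothTransition (ε * (t - T)) * ε) -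
          (p - 1) * α t * S t - p * S t)) t := fun t => by
    have h1 : HasDerivAt (fun t => (p - 1) * H t - p * t) ((p - 1) * (- α t) - p * 1) t :=
      ((hHd t).const_mul (p - 1)).sub ((hasDerivAt_id t).const_mul p)
    refine ((hSd t).mul (h1.exp.const_mul (m ^ (p - 1)))).congr_deriv ?_
    ring
  have hvB : ∀ x : EuclideanSpace ℝ (Fin N), x ≠ 0 →
      m ^ (p - 1) * Real.exp ((p - 1) * H (Real.log ‖x‖) - p * Real.log ‖x‖) =
        ‖x‖ ^ (-p) * v (Real.log ‖x‖) ^ (p - 1) := fun x hx => by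
    have h0 : 0 < ‖x‖ := norm_pos_iff.2 hx
    simp only [hv]
    rw [Real.mul_rpow hm.le (Real.exp_pos _).le, ← Real.exp_mul, Real.rpow_def_of_pos h0,
      sub_eq_add_neg ((p - 1) * H (Real.log ‖x‖)), Real.exp_add, show Real.log ‖x‖ * -p = -(p * Real.log ‖x‖) by ring,
      mul_comm (H (Real.log ‖x‖))]
    ring
  set V : EuclideanSpace ℝ (Fin N) → ℝ := logRadial T v with hVdef
  set b : EuclideanSpace ℝ (Fin N) → ℝ := logRadial T B with hbdef
  have hbc : ContDiff ℝ ∞ b := contDiff_logRadial hBc hBT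
  have hb1 : ContDiff ℝ 1 b := hbc.of_le (by exact_mod_cast le_top)
  have hflux : ∀ x, pFlux p (gradient V x) = -(b x • x) := fun x => by
    rcases eq_or_ne x 0 with rfl | hx
    · rw [hVdef, gradient_logRadial_zero hvT]
      simp [pFlux]
    · have h0 : 0 < ‖x‖ := norm_pos_iff.2 hx
      set t := Real.log ‖x‖ with ht
      rw [hVdef, gradient_logRadial hx (hvd t), hbdef, logRadial_of_ne hx, ← ht]
      have e1 : (-(v t * α t) / ‖x‖ ^ 2) • x =
          (v t * α t / ‖x‖) • (-(1 / ‖x‖) • x) := by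
        rw [smul_smul]
        congr 1
        field_simp
      have hn : ‖-(1 / ‖x‖) • x‖ = 1 := by
        rw [norm_smul, norm_neg, Real.norm_of_nonneg (by positivity)]
        field_simp
      have hk : 0 ≤ v t * α t / ‖x‖ := by
        have := hvpos t
        have := hα0 t
        positivity
      rw [e1, pFlux_smul hp hk, pFlux, hn, Real.one_rpow, one_smul,
        Real.div_rpow (mul_nonneg (hvpos t).le (hα0 t)) h0.le,
        Real.mul_rpow (hvpos t).le (hα0 t), hαS, smul_smul, ← neg_smul]
      congr 1
      simp only [hB]
      rw [hvB x hx, ← ht, show p - 1 = p + -1 by ring, Real.rpow_add h0, Real.rpow_neg_one,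
        Real.rpow_neg h0.le]
      have : 0 < ‖x‖ ^ p := by positivity
      field_simp
  refine ⟨V, fun x => N * b x + inner ℝ (gradient b x) x, contDiff_logRadial hvc hvT,
    fun x => ?_, ⟨v T, fun x => ?_⟩, fun x hx => ?_, ?_, fun φ hφ hs => ?_, fun x hx => ?_⟩
  · simp only [hVdef, logRadial]
    split_ifs
    exacts [hvpos _, hvpos _]
  · simp only [hVdef, logRadial]
    split_ifs
    · exact le_rfl
    · exact mul_le_mul_of_nonneg_left (Real.exp_le_exp.2 (hHle _)) hm.le
  · have h0 : 0 < ‖x‖ := hr.trans_le hx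
    rw [hVdef, logRadial_of_ne (norm_pos_iff.1 h0)]
    simp only [hv]
    rw [hHT₁ _ (Real.log_le_log hr hx), Real.rpow_def_of_pos (by positivity),
      Real.log_div hR.ne' h0.ne', mul_comm a]
  · exact (continuous_const.mul hb1.continuous).add (hb1.continuous_gradient.inner continuous_id)
  · have e : ∀ x, inner ℝ (pFlux p (gradient V x)) (gradient φ x) =
        -(b x * inner ℝ x (gradient φ x)) := fun x => by
      rw [hflux, inner_neg_left, real_inner_smul_left]
    simp only [e]
    rw [integral_neg, integral_mul_inner_gradient hb1 hφ hs, neg_neg]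
  · have h0 : 0 < ‖x‖ := norm_pos_iff.2 hx
    set t := Real.log ‖x‖ with ht
    have e1 : inner ℝ (gradient b x) x = m ^ (p - 1) * Real.exp ((p - 1) * H t - p * t) *
        (a ^ (p - 1) * (deriv Real.smoothTransition (ε * (t - T)) * ε) -
          (p - 1) * α t * S t - p * S t) := by
      rw [hbdef, gradient_logRadial hx (hBd t), real_inner_smul_left, real_inner_self_eq_norm_sq]
      field_simp
    simp only [e1]
    rw [hbdef, hVdef, logRadial_of_ne hx, logRadial_of_ne hx, ← ht]
    have e2 := hvB x hx
    rw [← ht] at e2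
    rw [mul_assoc lam, ← e2]
    have h1 : 0 < m ^ (p - 1) * Real.exp ((p - 1) * H t - p * t) := by positivity
    have h2 := hc (α t) ⟨hα0 t, hαa t⟩
    rw [hαS] at h2
    -- The divergence of `b x` is `|x|^{-p} V^{p-1}` times `α^{p-1} (N - p - (p-1) α) + S'`. The
    -- first summand is at most `c` by `hc`, and this step bounds `S'` by `lam - c`.
    have h3 : a ^ (p - 1) * (deriv Real.smoothTransition (ε * (t - T)) * ε) ≤ lam - c := by
      refine le_trans ?_ hεL
      rw [mul_comm ε L]
      gcongr
      exact hLd _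
    simp only [hB]
    nlinarith

/-! ### The Hardy term, the inequality for u, and a ball inside the domain -/

theorem integrableOn_norm_rpow_neg {N : ℕ} (hN : 0 < N) {s : ℝ} (hs : s < N)
    {Ω : Set (EuclideanSpace ℝ (Fin N))} (hΩ : MeasurableSet Ω) (hΩb : Bornology.IsBounded Ω) :
    IntegrableOn (fun x => ‖x‖ ^ (-s)) Ω := by
  have : NeZero N := ⟨hN.ne'⟩
  have : Nontrivial (EuclideanSpace ℝ (Fin N)) :=
    Module.nontrivial_of_finrank_pos (R := ℝ) (by simpa using hN)
  obtain ⟨D, hD0, hD⟩ : ∃ D : ℝ, 0 < D ∧ Ω ⊆ Metric.closedBall 0 D :=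
    hΩb.subset_closedBall_lt 0 0
  have h := (integrable_fun_norm_addHaar (volume : Measure (EuclideanSpace ℝ (Fin N)))
    (f := (Iic D).indicator fun y => y ^ (-s))).2 (by
      have h1 : IntegrableOn (fun y : ℝ => y ^ ((N : ℝ) - 1 - s)) (Ioc 0 D) :=
        (intervalIntegrable_iff_integrableOn_Ioc_of_le hD0.le).1
          (intervalIntegral.intervalIntegrable_rpow' (by linarith))
      have h2 : IntegrableOn ((Ioc 0 D).indicator fun y : ℝ => y ^ ((N : ℝ) - 1 - s)) (Ioi 0) :=
        ((integrable_indicator_iff measurableSet_Ioc).2 h1).integrableOn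
      refine h2.congr_fun (fun y hy => ?_) measurableSet_Ioi
      have hy0 : (0 : ℝ) < y := hy
      by_cases hyD : y ≤ D
      · rw [indicator_of_mem (show y ∈ Ioc 0 D from ⟨hy0, hyD⟩)]
        simp only [indicator_of_mem (show y ∈ Iic D from hyD), finrank_euclideanSpace,
          Fintype.card_fin, smul_eq_mul]
        rw [← Real.rpow_natCast, ← Real.rpow_add hy0, Nat.cast_sub hN]
        congr 1
        push_cast
        ring
      · rw [indicator_of_notMem (fun h => hyD h.2)]
        simp [hyD])
  refine h.integrableOn.congr_fun (fun x hx => ?_) hΩ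
  have : ‖x‖ ≤ D := by simpa using hD hx
  exact indicator_of_mem (show ‖x‖ ∈ Iic D from this) _

theorem integrableOn_hardy {N : ℕ} {p : ℝ} (hp : 1 < p) (hpN : p < N)
    {Ω : Set (EuclideanSpace ℝ (Fin N))} (hΩ : MeasurableSet Ω) (hΩb : Bornology.IsBounded Ω)
    {u : EuclideanSpace ℝ (Fin N) → ℝ}
    (hu : MemLp u (ENNReal.ofReal (N * p / (N - p))) (volume.restrict Ω)) :
    IntegrableOn (fun x => ‖x‖ ^ (-p) * |u x| ^ (p - 1)) Ω := by
  have hN : (0 : ℝ) < N := by linarith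
  have hNp : 0 < N - p := by linarith
  have hp1 : 0 < p - 1 := by linarith
  set P := N * p / (N - p) with hP
  have hPmul : P * (N - p) = N * p := by rw [hP]; field_simp
  have hPp : p < P := by
    rw [hP, lt_div_iff₀ hNp]; nlinarith
  have hs' : 1 < P / (p - 1) := by rw [lt_div_iff₀ hp1]; linarith
  obtain ⟨s, hss⟩ : ∃ s, (P / (p - 1)).HolderConjugate s :=
    ⟨_, Real.HolderConjugate.conjExponent hs'⟩
  have hsv : s = P / (P - (p - 1)) := by
    rw [hss.conjugate_eq]
    have : P - (p - 1) ≠ 0 := by linarith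
    have h2 : P / (p - 1) - 1 ≠ 0 := by linarith
    field_simp
  -- With `s` conjugate to `P/(p-1)`, this reduces to `N (p-1) < P (N-p) = N p`. It makes
  -- `|x|^{-ps}` integrable, and Young's inequality then bounds the Hardy term.
  have hpsN : p * s < N := by
    have h3 : 0 < P - (p - 1) := by linarith
    rw [hsv, ← mul_div_assoc, div_lt_iff₀ h3]
    nlinarith
  have i1 : IntegrableOn (fun x => ‖x‖ ^ (-(p * s))) Ω :=
    integrableOn_norm_rpow_neg (by exact_mod_cast hN) hpsN hΩ hΩb
  have hP0 : 0 < P := by linarith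
  have i2 : IntegrableOn (fun x => ‖u x‖ ^ P) Ω := by
    have := hu.integrable_norm_rpow (by simpa using hP0) ENNReal.ofReal_ne_top
    rwa [ENNReal.toReal_ofReal hP0.le] at this
  refine ((i1.div_const s).add (i2.div_const (P / (p - 1)))).mono' ?_
    (Eventually.of_forall fun x => ?_)
  · exact ((measurable_norm.pow_const (-p)).aestronglyMeasurable).mul
      (hu.1.norm.aemeasurable.pow_const (p - 1)).aestronglyMeasurable
  · have hn : 0 ≤ ‖x‖ ^ (-p) * |u x| ^ (p - 1) := by positivity
    rw [Real.norm_of_nonneg hn]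
    refine (Real.young_inequality_of_nonneg (by positivity) (by positivity) hss.symm).trans
      (le_of_eq ?_)
    rw [← Real.rpow_mul (norm_nonneg x), ← Real.rpow_mul (abs_nonneg _),
      mul_div_cancel₀ _ hp1.ne', neg_mul]
    rfl

theorem MeasureTheory.IntegrableOn.mul_isTestFunction {N : ℕ} {Ω Ω' : Set (EuclideanSpace ℝ (Fin N))}
    {g φ : EuclideanSpace ℝ (Fin N) → ℝ} (hg : IntegrableOn g Ω) (hφ : IsTestFunction Ω' φ) :
    IntegrableOn (fun x => g x * φ x) Ω := by
  obtain ⟨C, hC⟩ := hφ.2.1.exists_bound_of_continuous hφ.1.continuous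
  exact hg.mul_bdd hφ.1.continuous.aestronglyMeasurable (Eventually.of_forall hC)

/-- A nonnegative supersolution has a weak gradient `G ∈ L^p` with
`μ |x|^{-p} u^{p-1} ≤ -Δ_p u` in the weak sense. -/
theorem IsWeakSupersolution.exists_gradient {N : ℕ} {p μ : ℝ} (hp : 1 < p) (hpN : p < N)
    {Ω : Set (EuclideanSpace ℝ (Fin N))} (hΩ : MeasurableSet Ω) (hΩb : Bornology.IsBounded Ω)
    {f u : EuclideanSpace ℝ (Fin N) → ℝ}
    (hf_nonneg : ∀ᵐ x ∂(volume.restrict Ω), 0 ≤ f x) (hu : IsWeakSupersolution p μ Ω f u)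
    (hu_nonneg : ∀ᵐ x ∂(volume.restrict Ω), 0 ≤ u x) :
    IntegrableOn u Ω ∧ ∃ G : EuclideanSpace ℝ (Fin N) → EuclideanSpace ℝ (Fin N),
      HasWeakGradient Ω u G ∧ MemLp G (ENNReal.ofReal p) (volume.restrict Ω) ∧
      ∀ φ, IsTestFunction Ω φ → (∀ x, 0 ≤ φ x) →
        IntegrableOn (fun x => ‖x‖ ^ (-p) * u x ^ (p - 1) * φ x) Ω ∧
        IntegrableOn (fun x => inner ℝ (pFlux p (G x)) (gradient φ x)) Ω ∧
        ∫ x in Ω, μ * (‖x‖ ^ (-p) * u x ^ (p - 1) * φ x) ≤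
          ∫ x in Ω, inner ℝ (pFlux p (G x)) (gradient φ x) := by
  obtain ⟨⟨hup, G, hG, hGp⟩, hsub⟩ := hu
  have hup' : MemLp u (ENNReal.ofReal (N * p / (N - p))) (volume.restrict Ω) := by
    have h := hup.neg
    rwa [show (-fun x => -u x) = u from funext fun x => neg_neg (u x)] at h
  have hfin : IsFiniteMeasure (volume.restrict Ω) := ⟨by
    rw [Measure.restrict_apply_univ]; exact hΩb.measure_lt_top⟩
  have hP1 : 1 ≤ ENNReal.ofReal (N * p / (N - p)) := by
    have : 1 ≤ N * p / (N - p) := by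
      rw [le_div_iff₀ (by linarith)]
      nlinarith
    simpa using ENNReal.ofReal_le_ofReal this
  -- `G` is the weak gradient of `-u`, because a supersolution is defined through `-u`; the sign is
  -- reversed here.
  refine ⟨hup'.integrable hP1, fun x => - G x, ?_, hGp.neg, fun φ hφ hφ0 => ?_⟩
  · refine ⟨(show IntegrableOn u Ω volume from hup'.integrable hP1).locallyIntegrableOn, hG.2.1.neg, fun φ hφ i => ?_⟩
    have h := hG.2.2 φ hφ i
    simp only [neg_mul, integral_neg] at h
    simp only [PiLp.neg_apply, neg_mul, integral_neg]
    linarith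
  · have hmain := hsub G hG φ hφ hφ0
    have e1 : ∀ᵐ x ∂(volume.restrict Ω), |u x| ^ (p - 1) = u x ^ (p - 1) := by
      filter_upwards [hu_nonneg] with x hx
      rw [abs_of_nonneg hx]
    have i1 : IntegrableOn (fun x => ‖x‖ ^ (-p) * u x ^ (p - 1) * φ x) Ω := by
      refine (IntegrableOn.mul_isTestFunction (integrableOn_hardy hp hpN hΩ hΩb hup') hφ).congr ?_
      filter_upwards [e1] with x hx
      rw [hx]
    obtain ⟨q, hpq⟩ : ∃ q, p.HolderConjugate q := ⟨_, Real.HolderConjugate.conjExponent hp⟩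
    have hq1 : 1 ≤ ENNReal.ofReal q := by
      simpa using ENNReal.ofReal_le_ofReal hpq.symm.lt.le
    have hneg : ∀ x, pFlux p (- G x) = - pFlux p (G x) := fun x => by
      simp [pFlux]
    have i2 : IntegrableOn (fun x => inner ℝ (pFlux p (G x)) (gradient φ x)) Ω := by
      have hW := (memLp_pFlux hp hpq hGp).integrable hq1
      have hφ1 : ContDiff ℝ 1 φ := hφ.1.of_le (by exact_mod_cast le_top)
      have hgs : HasCompactSupport (gradient φ) :=
        HasCompactSupport.intro hφ.2.1 fun x hx => gradient_eq_zero_of_notMem_tsupport hx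
      obtain ⟨C, hC⟩ := hgs.exists_bound_of_continuous hφ1.continuous_gradient
      refine (hW.norm.mul_const C).mono'
        (hW.1.inner hφ1.continuous_gradient.aestronglyMeasurable) (Eventually.of_forall fun x => ?_)
      refine (norm_inner_le_norm _ _).trans ?_
      gcongr
      exact hC x
    refine ⟨i1, ?_, ?_⟩
    · simp only [hneg, inner_neg_left]
      exact i2.neg
    · have e2 : ∀ᵐ x ∂(volume.restrict Ω),
          ‖G x‖ ^ (p - 2) * inner ℝ (G x) (gradient φ x) -
            μ / ‖x‖ ^ p * |(- u x)| ^ (p - 2) * (- u x) * φ x =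
          inner ℝ (pFlux p (G x)) (gradient φ x) +
            μ * (‖x‖ ^ (-p) * u x ^ (p - 1) * φ x) := by
        filter_upwards [hu_nonneg] with x hx
        rw [abs_neg, abs_of_nonneg hx, pFlux, real_inner_smul_left,
          ← norm_rpow_sub_two_mul hp hx, Real.rpow_neg (norm_nonneg x)]
        ring
      rw [integral_congr_ae e2, integral_add i2 (i1.const_mul μ)] at hmain
      have h3 : ∫ x in Ω, f x * |(- u x)| ^ (p - 2) * (- u x) * φ x ≤ 0 := by
        refine integral_nonpos_of_ae ?_
        filter_upwards [hf_nonneg, hu_nonneg] with x h1 h2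
        have : 0 ≤ f x * |(- u x)| ^ (p - 2) * u x * φ x := by
          have := hφ0 x
          positivity
        change _ ≤ (0 : ℝ)
        linarith
      simp only [hneg, inner_neg_left, integral_neg]
      linarith

/-- The open ball misses the frontier, so it is covered by the disjoint open sets `Ω` and the
exterior of `Ω`. Being connected and meeting `Ω` at the origin, it cannot meet the exterior. -/
theorem ball_subset_of_frontier_norm_ge {E : Type*} [NormedAddCommGroup E] [NormedSpace ℝ E]
    {Ω : Set E} {R : ℝ} (hΩ : IsOpen Ω) (h0 : (0 : E) ∈ Ω) (hR : ∀ y ∈ frontier Ω, R ≤ ‖y‖) :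
    Metric.ball 0 R ⊆ Ω := by
  rcases le_or_gt R 0 with h | h
  · simp [Metric.ball_eq_empty.2 h]
  by_contra hc
  have hpre : IsPreconnected (Metric.ball (0 : E) R) := (convex_ball 0 R).isPreconnected
  obtain ⟨z, hz, hzΩ⟩ := not_subset.1 hc
  obtain ⟨y, hy, hyf⟩ : (Metric.ball (0 : E) R ∩ frontier Ω).Nonempty := by
    by_contra hne
    rw [not_nonempty_iff_eq_empty] at hne
    have hcov : Metric.ball (0 : E) R ⊆ Ω ∪ (closure Ω)ᶜ := fun y hy => by
      by_contra hy'
      rw [mem_union, not_or, mem_compl_iff, not_not] at hy'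
      have : y ∈ Metric.ball (0 : E) R ∩ frontier Ω :=
        ⟨hy, by rw [hΩ.frontier_eq]; exact ⟨hy'.2, hy'.1⟩⟩
      rw [hne] at this
      exact this
    have hzc : z ∈ (closure Ω)ᶜ := (hcov hz).resolve_left hzΩ
    obtain ⟨w, -, hw1, hw2⟩ := hpre Ω (closure Ω)ᶜ hΩ isClosed_closure.isOpen_compl hcov
      ⟨0, Metric.mem_ball_self h, h0⟩ ⟨z, hz, hzc⟩
    exact hw2 (subset_closure hw1)
  exact absurd (hR y hyf) (not_le.2 (mem_ball_zero_iff.1 hy))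

/-! ### The characteristic function of the exponents -/

section CharacteristicFunction

/-- The power `|x|^{-b}` solves `-Δ_p w = κ(b) |x|^{-p} w^{p-1}` with this `κ(b)`. -/
noncomputable def hardyCoeff (N : ℕ) (p b : ℝ) : ℝ := b ^ (p - 1) * (N - p - (p - 1) * b)

variable {N : ℕ} {p : ℝ}

theorem continuous_hardyCoeff (hp : 1 < p) : Continuous (hardyCoeff N p) := by
  unfold hardyCoeff
  exact (Real.continuous_rpow_const (by linarith)).mul (by fun_prop)

theorem deriv_hardyCoeff {b : ℝ} (hb : 0 < b) :
    deriv (hardyCoeff N p) b = (p - 1) * b ^ (p - 2) * (N - p - p * b) := by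
  have h1 := Real.hasDerivAt_rpow_const (x := b) (p := p - 1) (Or.inl hb.ne')
  have h2 : HasDerivAt (fun b : ℝ => N - p - (p - 1) * b) (-(p - 1)) b := by
    simpa using ((hasDerivAt_id b).const_mul (p - 1)).const_sub (N - p : ℝ)
  have h3 : deriv (hardyCoeff N p) b = _ := (h1.mul h2).deriv
  rw [h3, show p - 1 - 1 = p - 2 by ring, show b ^ (p - 1) = b ^ (p - 2) * b by
    rw [show p - 1 = p - 2 + 1 by ring, Real.rpow_add hb, Real.rpow_one]]
  ring

theorem strictMonoOn_hardyCoeff (hp : 1 < p) :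
    StrictMonoOn (hardyCoeff N p) (Icc 0 ((N - p) / p)) := by
  refine strictMonoOn_of_deriv_pos (convex_Icc _ _) (continuous_hardyCoeff hp).continuousOn
    fun b hb => ?_
  rw [interior_Icc] at hb
  have hb0 : 0 < b := hb.1
  have hb1 := hb.2
  rw [lt_div_iff₀ (by linarith)] at hb1
  rw [deriv_hardyCoeff hb.1]
  exact mul_pos (mul_pos (by linarith) (Real.rpow_pos_of_pos hb0 _)) (by linarith)

theorem strictAntiOn_hardyCoeff (hp : 1 < p) (hpN : p < N) :
    StrictAntiOn (hardyCoeff N p) (Ici ((N - p) / p)) := by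
  refine strictAntiOn_of_deriv_neg (convex_Ici _) (continuous_hardyCoeff hp).continuousOn
    fun b hb => ?_
  rw [interior_Ici] at hb
  have hb1 : (N - p) / p < b := hb
  have hb0 : 0 < b := lt_of_le_of_lt (div_nonneg (by linarith) (by linarith)) hb1
  rw [div_lt_iff₀ (by linarith)] at hb1
  rw [deriv_hardyCoeff hb0]
  exact mul_neg_of_pos_of_neg (mul_pos (by linarith) (Real.rpow_pos_of_pos hb0 _)) (by linarith)

theorem hardyCoeff_zero (hp : 1 < p) : hardyCoeff N p 0 = 0 := by
  rw [hardyCoeff, Real.zero_rpow (by linarith), zero_mul]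

theorem hardyCoeff_eq_of_root (hp : 1 < p) {μ γ : ℝ} (hγ : 0 ≤ γ)
    (h : γ ^ (p - 2) * ((p - 1) * γ ^ 2 - (N - p) * γ) + μ = 0) : hardyCoeff N p γ = μ := by
  rw [hardyCoeff, ← norm_rpow_sub_two_mul hp hγ]
  linear_combination -h

/-- If `γ₁` exceeded `(N-p)/p`, both roots would lie on the strictly decreasing branch and could not
share the value `μ`. -/
theorem AreCharacteristicRoots.le_div (hp : 1 < p) (hpN : p < N) {μ γ₁ γ₂ : ℝ}
    (h : AreCharacteristicRoots N p μ γ₁ γ₂) : γ₁ ≤ (N - p) / p := by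
  obtain ⟨h0, h12, e1, e2⟩ := h
  by_contra hc
  push Not at hc
  have := strictAntiOn_hardyCoeff hp hpN (mem_Ici.2 hc.le) (mem_Ici.2 (hc.le.trans h12.le)) h12
  rw [hardyCoeff_eq_of_root hp h0 e1, hardyCoeff_eq_of_root hp (h0.trans h12.le) e2] at this
  exact lt_irrefl _ this

end CharacteristicFunction

/-! ### Bootstrap with the barrier -/

/-- One step of the bootstrap: a lower bound of `u` by a multiple of the barrier improves. -/
theorem barrier_step {N : ℕ} (hN : 0 < N) {p μ lam R m k k' : ℝ} (hp : 1 < p) (hμ : 0 ≤ μ)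
    {Ω : Set (EuclideanSpace ℝ (Fin N))} (hΩ : IsOpen Ω) (hΩb : Bornology.IsBounded Ω)
    (hR : Metric.closedBall 0 R ⊆ Ω)
    {u : EuclideanSpace ℝ (Fin N) → ℝ}
    {G : EuclideanSpace ℝ (Fin N) → EuclideanSpace ℝ (Fin N)}
    (hu : IntegrableOn u Ω) (hG : HasWeakGradient Ω u G)
    (hGp : MemLp G (ENNReal.ofReal p) (volume.restrict Ω))
    (hum : ∀ᵐ x ∂(volume.restrict Ω), m ≤ u x)
    (hsup : ∀ φ, IsTestFunction Ω φ → (∀ x, 0 ≤ φ x) →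
        IntegrableOn (fun x => ‖x‖ ^ (-p) * u x ^ (p - 1) * φ x) Ω ∧
        IntegrableOn (fun x => inner ℝ (pFlux p (G x)) (gradient φ x)) Ω ∧
        ∫ x in Ω, μ * (‖x‖ ^ (-p) * u x ^ (p - 1) * φ x) ≤
          ∫ x in Ω, inner ℝ (pFlux p (G x)) (gradient φ x))
    {V g : EuclideanSpace ℝ (Fin N) → ℝ} (hV : ContDiff ℝ ∞ V) (hV0 : ∀ x, 0 < V x)
    (hVm : ∀ x, R ≤ ‖x‖ → V x ≤ m) (hgc : Continuous g)
    (hVg : ∀ φ, ContDiff ℝ 1 φ → HasCompactSupport φ →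
        ∫ x, inner ℝ (pFlux p (gradient V x)) (gradient φ x) = ∫ x, g x * φ x)
    (hg : ∀ x, x ≠ 0 → g x ≤ lam * ‖x‖ ^ (-p) * V x ^ (p - 1))
    (hk : 0 ≤ k) (hk' : 0 ≤ k') (hk'1 : k' ≤ 1) (hkk' : lam * k' ^ (p - 1) ≤ μ * k ^ (p - 1))
    (huk : ∀ᵐ x ∂(volume.restrict Ω), k * V x ≤ u x) :
    ∀ᵐ x ∂(volume.restrict Ω), k' * V x ≤ u x := by
  have : NeZero N := ⟨hN.ne'⟩
  have : Nontrivial (EuclideanSpace ℝ (Fin N)) :=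
    Module.nontrivial_of_finrank_pos (R := ℝ) (by simpa using hN)
  have hΩm := hΩ.measurableSet
  refine weak_comparison (V := fun x => k' * V x) hN hp hΩ hΩb hR hu hG hGp hum
    (contDiff_const.mul hV)
    (fun x hx => (mul_le_of_le_one_left (hV0 x).le hk'1).trans (hVm x hx)) fun φ hφ hφ0 => ?_
  obtain ⟨i1, i2, h1⟩ := hsup φ hφ hφ0
  have hφ1 : ContDiff ℝ 1 φ := hφ.1.of_le (by exact_mod_cast le_top)
  have hgradV : ∀ x, gradient (fun x => k' * V x) x = k' • gradient V x := fun x => by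
    rw [gradient, fderiv_const_mul (hV.differentiable (by simp) x), map_smul]
    rfl
  have hcV : Continuous fun x => gradient V x :=
    (hV.of_le (by exact_mod_cast le_top)).continuous_gradient
  have hsupp : ∀ x ∉ Ω, gradient φ x = 0 := fun x hx =>
    gradient_eq_zero_of_notMem_tsupport fun h => hx (hφ.2.2 h)
  have i3 : Integrable fun x => g x * φ x :=
    (hgc.mul hφ.1.continuous).integrable_of_hasCompactSupport hφ.2.1.mul_left
  have e1 : ∫ x in Ω, inner ℝ (pFlux p (gradient V x)) (gradient φ x) = ∫ x in Ω, g x * φ x := by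
    rw [setIntegral_eq_integral_of_forall_compl_eq_zero fun x hx => by simp [hsupp x hx],
      hVg φ hφ1 hφ.2.1, setIntegral_eq_integral_of_forall_compl_eq_zero fun x hx => ?_]
    rw [image_eq_zero_of_notMem_tsupport fun h => hx (hφ.2.2 h), mul_zero]
  have i4 : IntegrableOn (fun x => inner ℝ (pFlux p (gradient V x)) (gradient φ x)) Ω := by
    obtain ⟨q, hpq⟩ : ∃ q, p.HolderConjugate q := ⟨_, Real.HolderConjugate.conjExponent hp⟩
    have hgs : HasCompactSupport (gradient φ) :=
      HasCompactSupport.intro hφ.2.1 fun x hx => gradient_eq_zero_of_notMem_tsupport hx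
    obtain ⟨C, hC⟩ := hΩb.isCompact_closure.exists_bound_of_continuousOn hcV.continuousOn
    have hmem : MemLp (gradient V) (ENNReal.ofReal p) (volume.restrict Ω) := by
      have hfin : IsFiniteMeasure (volume.restrict Ω) := ⟨by
        rw [Measure.restrict_apply_univ]; exact hΩb.measure_lt_top⟩
      refine MemLp.of_bound hcV.aestronglyMeasurable C ?_
      filter_upwards [ae_restrict_mem hΩm] with x hx using hC x (subset_closure hx)
    have hφm : MemLp (gradient φ) (ENNReal.ofReal p) (volume.restrict Ω) :=
      (hφ1.continuous_gradient.memLp_of_hasCompactSupport hgs).restrict Ω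
    have hW := memLp_pFlux hp hpq hmem
    have := hpq.symm.ennrealOfReal
    refine (hW.norm.integrable_mul hφm.norm).mono' (hW.1.inner hφm.1)
      (Eventually.of_forall fun x => norm_inner_le_norm _ _)
  have e2 : ∀ x, inner ℝ (pFlux p (gradient (fun x => k' * V x) x) - pFlux p (G x))
      (gradient φ x) = k' ^ (p - 1) * inner ℝ (pFlux p (gradient V x)) (gradient φ x) -
        inner ℝ (pFlux p (G x)) (gradient φ x) := fun x => by
    rw [hgradV, pFlux_smul hp hk', inner_sub_left, real_inner_smul_left]
  simp only [e2]
  rw [integral_sub (i4.const_mul _) i2, integral_const_mul, e1, ← integral_const_mul]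
  -- Off the origin the source of `k' V` is at most `lam k'^{p-1} |x|^{-p} V^{p-1}`. The relation
  -- between `k` and `k'` and then `k V ≤ u` bound this by the source of `u`.
  have hmono : ∫ x in Ω, k' ^ (p - 1) * (g x * φ x) ≤
      ∫ x in Ω, μ * (‖x‖ ^ (-p) * u x ^ (p - 1) * φ x) := by
    refine integral_mono_ae (i3.integrableOn.const_mul _) (i1.const_mul _) ?_
    have hne : ∀ᵐ x ∂(volume.restrict Ω), x ≠ (0 : EuclideanSpace ℝ (Fin N)) :=
      ae_restrict_of_ae (Measure.ae_ne volume 0)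
    filter_upwards [huk, hne] with x hx hx0
    have hk'p : 0 ≤ k' ^ (p - 1) := by positivity
    have hVx := hV0 x
    have hA : 0 ≤ ‖x‖ ^ (-p) * V x ^ (p - 1) * φ x := by
      have := hφ0 x
      positivity
    calc k' ^ (p - 1) * (g x * φ x)
        ≤ k' ^ (p - 1) * (lam * ‖x‖ ^ (-p) * V x ^ (p - 1) * φ x) := by
          gcongr
          · exact hφ0 x
          · exact hg x hx0
      _ = lam * k' ^ (p - 1) * (‖x‖ ^ (-p) * V x ^ (p - 1) * φ x) := by ring
      _ ≤ μ * k ^ (p - 1) * (‖x‖ ^ (-p) * V x ^ (p - 1) * φ x) := by gcongr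
      _ = μ * (‖x‖ ^ (-p) * (k * V x) ^ (p - 1) * φ x) := by
          rw [Real.mul_rpow hk hVx.le]
          ring
      _ ≤ μ * (‖x‖ ^ (-p) * u x ^ (p - 1) * φ x) := by
          gcongr
          exact hφ0 x
  linarith

/-- The comparison with the barrier, for a subcritical exponent and away from the origin. -/
theorem le_of_supersolution_of_hardyCoeff_lt {N : ℕ} {p μ a R r m : ℝ} (hp : 1 < p)
    (hpN : p < N) (hμ : 0 < μ) (ha : 0 < a) (haN : a ≤ (N - p) / p) (haμ : hardyCoeff N p a < μ)
    (hm : 0 < m) (hr : 0 < r) (hrR : r ≤ R)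
    {Ω : Set (EuclideanSpace ℝ (Fin N))} (hΩ : IsOpen Ω) (hΩb : Bornology.IsBounded Ω)
    (hR : Metric.closedBall 0 R ⊆ Ω)
    {f u : EuclideanSpace ℝ (Fin N) → ℝ}
    (hf_nonneg : ∀ᵐ x ∂(volume.restrict Ω), 0 ≤ f x) (hu : IsWeakSupersolution p μ Ω f u)
    (hum : ∀ᵐ x ∂(volume.restrict Ω), m ≤ u x) :
    ∀ᵐ x ∂(volume.restrict Ω), r ≤ ‖x‖ → m * (R / ‖x‖) ^ a ≤ u x := by
  have hN : 0 < N := by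
    have : (0 : ℝ) < N := by linarith
    exact_mod_cast this
  have hp1 : 0 < p - 1 := by linarith
  obtain ⟨hui, G, hG, hGp, hsup⟩ := hu.exists_gradient hp hpN hΩ.measurableSet hΩb hf_nonneg
    (hum.mono fun x hx => hm.le.trans hx)
  -- The maximum with `0` keeps `lam` positive, so that `μ / lam` is meaningful.
  obtain ⟨lam, hlam1, hlam2⟩ := exists_between (max_lt haμ hμ)
  have hlam0 : 0 < lam := (le_max_right _ _).trans_lt hlam1
  obtain ⟨V, g, hV, hV0, ⟨M, hM⟩, hVr, hgc, hVg, hg⟩ := exists_barrier (N := N) (lam := lam)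
    (m := m) hp ha (fun b hb => (strictMonoOn_hardyCoeff hp).monotoneOn ⟨hb.1, hb.2.trans haN⟩
      ⟨ha.le, haN⟩ hb.2) ((le_max_left _ _).trans_lt hlam1) hm hr hrR
  have hR0 : 0 < R := hr.trans_le hrR
  have hVm : ∀ x, R ≤ ‖x‖ → V x ≤ m := fun x hx => by
    rw [hVr x (hrR.trans hx)]
    refine mul_le_of_le_one_right hm.le (Real.rpow_le_one (by positivity) ?_ ha.le)
    rw [div_le_one (hR0.trans_le hx)]
    exact hx
  have hM0 : 0 < M := (hV0 0).trans_le (hM 0)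
  -- The gain per step: the largest factor for which `lam (θ k)^{p-1} ≤ μ k^{p-1}`.
  set θ := (μ / lam) ^ (1 / (p - 1)) with hθ
  have hθ1 : 1 < θ := Real.one_lt_rpow (by rwa [one_lt_div hlam0]) (by positivity)
  have hθp : lam * θ ^ (p - 1) = μ := by
    rw [hθ, ← Real.rpow_mul (by positivity), one_div_mul_cancel hp1.ne', Real.rpow_one]
    field_simp
  -- The truncation at `1` preserves `k V ≤ m` for `|x| ≥ R`, which comparison requires. The start
  -- `m / M` works because `V ≤ M` and `m ≤ u`.
  have hiter : ∀ n : ℕ, ∀ᵐ x ∂(volume.restrict Ω), min 1 (θ ^ n * (m / M)) * V x ≤ u x := by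
    intro n
    induction n with
    | zero =>
      filter_upwards [hum] with x hx
      refine le_trans ?_ hx
      calc min 1 (θ ^ 0 * (m / M)) * V x ≤ m / M * M := by
            have := hV0 x
            have := hM x
            gcongr
            simp
        _ = m := by field_simp
    | succ n ih =>
      have hθn : 0 < θ ^ n * (m / M) := by positivity
      have hmin : 0 < min 1 (θ ^ n * (m / M)) := lt_min one_pos hθn
      have hmin' : 0 ≤ min 1 (θ ^ (n + 1) * (m / M)) := le_min zero_le_one (by positivity)
      refine barrier_step hN hp hμ.le hΩ hΩb hR hui hG hGp hum hsup hV hV0 hVm hgc hVg hg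
        hmin.le hmin' (min_le_left _ _) ?_ ih
      have h1 : min 1 (θ ^ (n + 1) * (m / M)) ≤ θ * min 1 (θ ^ n * (m / M)) := by
        rw [mul_min_of_nonneg _ _ (by positivity)]
        refine le_min ((min_le_left _ _).trans (by linarith)) ((min_le_right _ _).trans ?_)
        rw [pow_succ]
        exact le_of_eq (by ring)
      calc lam * min 1 (θ ^ (n + 1) * (m / M)) ^ (p - 1)
          ≤ lam * (θ * min 1 (θ ^ n * (m / M))) ^ (p - 1) := by gcongr
        _ = μ * min 1 (θ ^ n * (m / M)) ^ (p - 1) := by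
          rw [Real.mul_rpow (by positivity) hmin.le, ← mul_assoc, hθp]
  obtain ⟨n, hn⟩ := ((tendsto_pow_atTop_atTop_of_one_lt hθ1).atTop_mul_const
    (show 0 < m / M by positivity)).eventually_ge_atTop 1 |>.exists
  filter_upwards [hiter n] with x hx hxr
  rw [min_eq_left hn, one_mul, hVr x hxr] at hx
  exact hx

/-! ### Conclusion by approximation of the exponent and the radius -/

theorem theorem1p4 (N : ℕ) (p μ : ℝ) (hp : 1 < p) (hpN : p < N)
    (hμ₀ : 0 ≤ μ) (hμ₁ : μ < ((N - p) / p) ^ p)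
    (γ₁ γ₂ : ℝ) (hγ : AreCharacteristicRoots N p μ γ₁ γ₂)
    (Ω : Set (EuclideanSpace ℝ (Fin N))) (hΩ_open : IsOpen Ω) (hΩ_conn : IsConnected Ω)
    (hΩ_bdd : Bornology.IsBounded Ω) (hΩ_zero : (0 : EuclideanSpace ℝ (Fin N)) ∈ Ω)
    (f : EuclideanSpace ℝ (Fin N) → ℝ)
    (hf : MemLp f (ENNReal.ofReal (N / p)) (volume.restrict Ω))
    (hf_nonneg : ∀ᵐ x ∂(volume.restrict Ω), 0 ≤ f x)
    (u : EuclideanSpace ℝ (Fin N) → ℝ) (hu : IsWeakSupersolution p μ Ω f u)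
    (hu_nonneg : ∀ᵐ x ∂(volume.restrict Ω), 0 ≤ u x) :
    ∀ᵐ x ∂(volume.restrict Ω),
      sInf ((fun y : EuclideanSpace ℝ (Fin N) => ‖y‖ ^ γ₁) '' frontier Ω)
        * essInf u (volume.restrict Ω) * ‖x‖ ^ (-γ₁) ≤ u x := by
  have hN : 0 < N := by
    have : (0 : ℝ) < N := by linarith
    exact_mod_cast this
  have : NeZero N := ⟨hN.ne'⟩
  have : Nontrivial (EuclideanSpace ℝ (Fin N)) :=
    Module.nontrivial_of_finrank_pos (R := ℝ) (by simpa using hN)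
  set C := sInf ((fun y : EuclideanSpace ℝ (Fin N) => ‖y‖ ^ γ₁) '' frontier Ω) with hC
  set m := essInf u (volume.restrict Ω) with hm
  have hum : ∀ᵐ x ∂(volume.restrict Ω), m ≤ u x :=
    ae_essInf_le (isBoundedUnder_of_eventually_ge hu_nonneg)
  have hbdd : BddBelow ((fun y : EuclideanSpace ℝ (Fin N) => ‖y‖ ^ γ₁) '' frontier Ω) :=
    ⟨0, by rintro _ ⟨y, -, rfl⟩; positivity⟩
  have hC0 : 0 ≤ C := Real.sInf_nonneg (by rintro _ ⟨y, -, rfl⟩; positivity)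
  have hle : ∀ y ∈ frontier Ω, C ≤ ‖y‖ ^ γ₁ := fun y hy => csInf_le hbdd ⟨y, hy, rfl⟩
  rcases le_or_gt m 0 with hm0 | hm0
  · filter_upwards [hu_nonneg] with x hx
    exact (mul_nonpos_of_nonpos_of_nonneg (mul_nonpos_of_nonneg_of_nonpos hC0 hm0)
      (by positivity)).trans hx
  rcases hC0.eq_or_lt with hC0 | hC0
  · filter_upwards [hu_nonneg] with x hx
    rwa [← hC0, zero_mul, zero_mul]
  rcases hγ.1.eq_or_lt with hγ0 | hγ0
  · have hC1 : C ≤ 1 := by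
      rcases (frontier Ω).eq_empty_or_nonempty with h | ⟨y, hy⟩
      · rw [hC, h, image_empty, Real.sInf_empty]
        exact zero_le_one
      · simpa [← hγ0] using hle y hy
    filter_upwards [hum] with x hx
    rw [← hγ0, neg_zero, Real.rpow_zero, mul_one]
    exact (mul_le_of_le_one_left hm0.le hC1).trans hx
  have hγN := hγ.le_div hp hpN
  have hγμ : hardyCoeff N p γ₁ = μ := hardyCoeff_eq_of_root hp hγ.1 hγ.2.2.1
  have hmono := strictMonoOn_hardyCoeff (N := N) hp
  have hμ : 0 < μ := by
    have := hmono ⟨le_rfl, hγ0.le.trans hγN⟩ ⟨hγ0.le, hγN⟩ hγ0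
    rwa [hardyCoeff_zero hp, hγμ] at this
  -- Chosen so that `R^{γ₁} = C`; every frontier point then has norm at least `R`.
  set R := C ^ (1 / γ₁) with hRdef
  have hR0 : 0 < R := Real.rpow_pos_of_pos hC0 _
  have hRγ : R ^ γ₁ = C := by
    rw [hRdef, ← Real.rpow_mul hC0.le, one_div_mul_cancel hγ0.ne', Real.rpow_one]
  have hball : Metric.ball 0 R ⊆ Ω := by
    refine ball_subset_of_frontier_norm_ge hΩ_open hΩ_zero fun y hy => ?_
    rw [← Real.rpow_le_rpow_iff hR0.le (norm_nonneg y) hγ0, hRγ]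
    exact hle y hy
  -- approximation from below of the exponent and the radius
  let σ : ℕ → ℝ := fun n => 1 - 1 / ((n : ℝ) + 2)
  have hσ1 : ∀ n, σ n < 1 := fun n => by
    have : 0 < 1 / ((n : ℝ) + 2) := by positivity
    simp only [σ]
    linarith
  have hσ0 : ∀ n, 0 < σ n := fun n => by
    have : 1 / ((n : ℝ) + 2) < 1 := by
      rw [div_lt_one (by positivity)]
      linarith [(Nat.cast_nonneg n : (0 : ℝ) ≤ n)]
    simp only [σ]
    linarith
  have hδ : Tendsto (fun n : ℕ => 1 / ((n : ℝ) + 2)) atTop (𝓝 0) := by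
    have h := (tendsto_add_atTop_iff_nat 1).2 (tendsto_one_div_add_atTop_nhds_zero_nat (𝕜 := ℝ))
    refine h.congr fun n => ?_
    push_cast
    ring
  have hσlim : Tendsto σ atTop (𝓝 1) := by
    simpa [σ] using hδ.const_sub 1
  -- The factor `σ n < 1` makes the exponent strictly less than `γ₁` and puts the closed ball of
  -- radius `R σ n` inside `Ω`. The inner radius tends to `0`, so each `x ≠ 0` is eventually
  -- covered; the countably many null sets are discarded together.
  have hn : ∀ n : ℕ, ∀ᵐ x ∂(volume.restrict Ω), R * σ n * (1 / ((n : ℝ) + 2)) ≤ ‖x‖ →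
      m * (R * σ n / ‖x‖) ^ (γ₁ * σ n) ≤ u x := fun n => by
    have hlt : γ₁ * σ n < γ₁ := mul_lt_of_lt_one_right hγ0 (hσ1 n)
    have ha0 : 0 < γ₁ * σ n := mul_pos hγ0 (hσ0 n)
    have hRn : 0 < R * σ n := mul_pos hR0 (hσ0 n)
    have hlt2 := hmono ⟨ha0.le, hlt.le.trans hγN⟩ ⟨hγ0.le, hγN⟩ hlt
    rw [hγμ] at hlt2
    refine le_of_supersolution_of_hardyCoeff_lt hp hpN hμ ha0 (hlt.le.trans hγN) hlt2 hm0
      (by positivity) ?_ hΩ_open hΩ_bdd ?_ hf_nonneg hu hum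
    · refine mul_le_of_le_one_right hRn.le ?_
      rw [div_le_one (by positivity)]
      linarith [(Nat.cast_nonneg n : (0 : ℝ) ≤ n)]
    · exact (Metric.closedBall_subset_ball (mul_lt_of_lt_one_right hR0 (hσ1 n))).trans hball
  have hne : ∀ᵐ x ∂(volume.restrict Ω), x ≠ (0 : EuclideanSpace ℝ (Fin N)) :=
    ae_restrict_of_ae (Measure.ae_ne volume 0)
  filter_upwards [ae_all_iff.2 hn, hne] with x hx hx0
  have hx' : 0 < ‖x‖ := norm_pos_iff.2 hx0
  have hlim : Tendsto (fun n => m * (R * σ n / ‖x‖) ^ (γ₁ * σ n)) atTop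
      (𝓝 (m * (R * 1 / ‖x‖) ^ (γ₁ * 1))) :=
    (((hσlim.const_mul R).div_const _).rpow (hσlim.const_mul γ₁)
      (Or.inl (by positivity))).const_mul m
  have hev : ∀ᶠ n : ℕ in atTop, R * σ n * (1 / ((n : ℝ) + 2)) ≤ ‖x‖ := by
    have h := (hσlim.const_mul R).mul hδ
    rw [mul_zero] at h
    exact (h.eventually (gt_mem_nhds hx')).mono fun n hn => hn.le
  have hfinal := le_of_tendsto hlim (hev.mono fun n hn => hx n hn)
  refine le_trans (le_of_eq ?_) hfinal
  rw [mul_one, mul_one, Real.div_rpow hR0.le hx'.le, hRγ, Real.rpow_neg hx'.le]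
  ring
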